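/- Let $n\ge 1$ and let $X=X^*\in M_n(\mathbb C)$. Write $\|A\|_\infty$ for the operator norm on $\mathbb C^n$, $\|Y\|_S=\sup\{\|Y\circ A\|_\infty : \|A\|_\infty\le 1\}$ for the Schur multiplier norm ($\circ$ is the entrywise product), and $\|X\|_{cbB}=\sup\{|\mathrm{Tr}(Y^*X)| : \|Y\|_S\le 1\}$ for its dual norm. Let $\mathcal S$ be the set of unit vectors of $\mathbb C^n$, let $P_\xi$ be the orthogonal projection onto $\mathbb C\xi$, and let $\Delta(\gamma)$ be the diagonal matrix with diagonal $\gamma$. Consider the linear program $$(\mathcal P):\quad \min\sum_{j=1}^n\lambda_j\quad\text{subject to } \lambda_j\ge 0 \text{ for all } j,\quad \pm\langle X\xi,\xi\rangle\le\sum_j\lambda_j|\xi_j|^2\text{ for all }\xi\in\mathcal S,$$ and its dual, with variables $(\mu_\xi)_{\xi\in\mathcal S}$ and $(\nu_\eta)_{\eta\in\mathcal S}$, $$(\mathcal P^*):\quad \max\Big(\sum_{\xi}\mu_\xi\langle X\xi,\xi\rangle-\sum_\eta\nu_\eta\langle X\eta,\eta\rangle\Big)\quad\text{subject to }\mu_\xi,\nu_\eta\ge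 0,\quad \sum_\xi\mu_\xi|\xi_j|^2+\sum_\eta\nu_\eta|\eta_j|^2\le 1\text{ for all }j.$$ A solution of $(\mathcal P^*)$ is called finite if only finitely many of its variables are nonzero. (1) The optimal value of $(\mathcal P)$ and of $(\mathcal P^*)$ is $\|X\|_{cbB}$; both optima are attained, that of $(\mathcal P^*)$ by a finite solution. (2) Call $X=\Delta(\eta)B\Delta(\xi)$ a cbB-factorization if $\eta_j,\xi_j\ge0$, $\|\eta\|_2=\|\xi\|_2=1$, $\|B\|_\infty=\|X\|_{cbB}$, the range of $B$ is contained in the support of $\Delta(\eta)$ and the support of $B$ is contained in the support of $\Delta(\xi)$. Such a factorization exists with $\eta=\xi$ and $B=B^*$, and it is the only one if $X\ne0$. For every cbB-factorization of $X$, $\lambda_j:=\|X\|_{cbB}\,\xi_j^2$ is an optimal solution of $(\mathcal P)$. (3) Let $Y=Y^*\in M_n(\mathbb C)$ satisfy $\|Y\|_S=1$ and $\mathrm{Tr}(YX)=\|X\|_{cbB}$, and let $Y=ESE$ be any self-adjoint Schur factorization, that is, $E\ge0$, $\mathrm{diag}(E^2)\le\|Y\|_S I$ and $S$ is a self-adjoint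 isometry. Put $F=\frac12(I+S)$ and $G=\frac12(I-S)$. Then there are spectral decompositions $EFE=\sum_{s}\mu_sP_{\xi_s}$ and $EGE=\sum_{t}\nu_tP_{\eta_t}$ with finite orthonormal sets $\{\xi_s\}$, $\{\eta_t\}$ and $\mu_s,\nu_t>0$, and for all such decompositions, setting $\mu_{\xi_s}=\mu_s$, $\nu_{\eta_t}=\nu_t$ and all other variables $0$ gives a finite optimal solution of $(\mathcal P^*)$, with value $\|X\|_{cbB}$. (4) Let $(\mu_\xi),(\nu_\eta)$ be any finite optimal solution of $(\mathcal P^*)$, and put $Z=\sum_\xi\mu_\xi P_\xi-\sum_\eta\nu_\eta P_\eta$. Then $\mathrm{Tr}(ZX)=\|X\|_{cbB}$, and if $X\neq0$ then $\|Z\|_S=1$ and also $\big\|\sum_\xi\mu_\xi P_\xi+\sum_\eta\nu_\eta P_\eta\big\|_S=1$. -/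

import Mathlib

open scoped Matrix ComplexOrder

namespace SchurLP

noncomputable section

/-- The operator norm of a complex `n × n` matrix acting on the Hilbert space `ℂⁿ`. -/
def opNorm {n : ℕ} (A : Matrix (Fin n) (Fin n) ℂ) : ℝ :=
  ‖Matrix.toEuclideanCLM (n := Fin n) (𝕜 := ℂ) A‖

/-- The Schur multiplier norm: the norm of `Y ↦ X ⊙ Y` (entrywise product) with respect to the
operator norm. -/
def schurNorm {n : ℕ} (X : Matrix (Fin n) (Fin n) ℂ) : ℝ :=
  sSup {r : ℝ | ∃ Y : Matrix (Fin n) (Fin n) ℂ, opNorm Y ≤ 1 ∧ r = opNorm (X ⊙ Y)}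

/-- The norm dual to the Schur multiplier norm under the pairing `Tr (Yᴴ X)`. -/
def cbBNorm {n : ℕ} (X : Matrix (Fin n) (Fin n) ℂ) : ℝ :=
  sSup {r : ℝ | ∃ Y : Matrix (Fin n) (Fin n) ℂ, schurNorm Y ≤ 1 ∧ r = ‖(Yᴴ * X).trace‖}

/-- The set of unit vectors of `ℂⁿ` with the Euclidean norm. -/
abbrev UnitVec (n : ℕ) : Type :=
  Metric.sphere (0 : EuclideanSpace ℂ (Fin n)) 1

/-- The coordinates of a unit vector. -/
def UnitVec.coord {n : ℕ} (ξ : UnitVec n) : Fin n → ℂ :=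
  WithLp.ofLp (ξ : EuclideanSpace ℂ (Fin n))

/-- `⟨X ξ, ξ⟩`, which is a real number when `X` is self-adjoint. -/
def quadForm {n : ℕ} (X : Matrix (Fin n) (Fin n) ℂ) (ξ : UnitVec n) : ℝ :=
  (star ξ.coord ⬝ᵥ (X *ᵥ ξ.coord)).re

/-- `P_ξ = ξ ξ*`, the orthogonal projection onto `ℂ ξ`, for a unit vector `ξ`. -/
def proj {n : ℕ} (ξ : UnitVec n) : Matrix (Fin n) (Fin n) ℂ :=
  Matrix.vecMulVec ξ.coord (star ξ.coord)

/-! The primal program -/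

/-- The constraints of the primal program. -/
structure PrimalFeasible {n : ℕ} (X : Matrix (Fin n) (Fin n) ℂ) (l : Fin n → ℝ) : Prop where
  nonneg : ∀ j, 0 ≤ l j
  upper : ∀ ξ : UnitVec n, quadForm X ξ ≤ ∑ j, l j * ‖ξ.coord j‖ ^ 2
  lower : ∀ η : UnitVec n, -quadForm X η ≤ ∑ j, l j * ‖η.coord j‖ ^ 2

/-- The values of the primal objective at feasible solutions. -/
def primalValues {n : ℕ} (X : Matrix (Fin n) (Fin n) ℂ) : Set ℝ :=
  {v | ∃ l : Fin n → ℝ, PrimalFeasible X l ∧ v = ∑ j, l j}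

/-- An optimal solution of the primal program. -/
def PrimalOptimal {n : ℕ} (X : Matrix (Fin n) (Fin n) ℂ) (l : Fin n → ℝ) : Prop :=
  PrimalFeasible X l ∧ ∀ l' : Fin n → ℝ, PrimalFeasible X l' → ∑ j, l j ≤ ∑ j, l' j

/-! The dual program -/

/-- The constraints of the dual program. The variables are indexed by all unit vectors, and
infinitely many of them may be nonzero, so finiteness of the sums is part of feasibility. -/
structure DualFeasible {n : ℕ} (μ ν : UnitVec n → ℝ) : Prop where
  nonneg_left : ∀ ξ, 0 ≤ μ ξ
  nonneg_right : ∀ η, 0 ≤ ν η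
  summable_left : ∀ j, Summable fun ξ : UnitVec n => μ ξ * ‖ξ.coord j‖ ^ 2
  summable_right : ∀ j, Summable fun η : UnitVec n => ν η * ‖η.coord j‖ ^ 2
  le_one : ∀ j, ∑' ξ : UnitVec n, μ ξ * ‖ξ.coord j‖ ^ 2
    + ∑' η : UnitVec n, ν η * ‖η.coord j‖ ^ 2 ≤ 1

/-- The dual objective. For feasible `μ, ν` both series converge absolutely, since adding the
constraints over `j` gives `∑ μ + ∑ ν ≤ n` and `ξ ↦ ⟨X ξ, ξ⟩` is bounded. -/
def dualValue {n : ℕ} (X : Matrix (Fin n) (Fin n) ℂ) (μ ν : UnitVec n → ℝ) : ℝ :=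
  ∑' ξ : UnitVec n, μ ξ * quadForm X ξ - ∑' η : UnitVec n, ν η * quadForm X η

/-- The values of the dual objective at feasible solutions. -/
def dualValues {n : ℕ} (X : Matrix (Fin n) (Fin n) ℂ) : Set ℝ :=
  {v | ∃ μ ν : UnitVec n → ℝ, DualFeasible μ ν ∧ v = dualValue X μ ν}

/-- An optimal solution of the dual program. -/
def DualOptimal {n : ℕ} (X : Matrix (Fin n) (Fin n) ℂ) (μ ν : UnitVec n → ℝ) : Prop :=
  DualFeasible μ ν ∧
    ∀ μ' ν' : UnitVec n → ℝ, DualFeasible μ' ν' → dualValue X μ' ν' ≤ dualValue X μ ν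

/-- Only finitely many variables are nonzero. -/
def FiniteSolution {n : ℕ} (μ ν : UnitVec n → ℝ) : Prop :=
  (Function.support μ).Finite ∧ (Function.support ν).Finite

/-- `∑ μ_ξ P_ξ`, for finitely supported `μ`. -/
def projSum {n : ℕ} (μ : UnitVec n → ℝ) : Matrix (Fin n) (Fin n) ℂ :=
  ∑ᶠ ξ : UnitVec n, (μ ξ : ℂ) • proj ξ

/-! Factorizations -/

/-- The diagonal matrix `Δ(γ)` of a real vector. -/
def diagMat {n : ℕ} (γ : Fin n → ℝ) : Matrix (Fin n) (Fin n) ℂ :=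
  Matrix.diagonal fun j => (γ j : ℂ)

/-- A cbB-factorization `X = Δ(η) B Δ(ξ)`, with `η, ξ` nonnegative unit vectors, `B` of operator
norm `‖X‖_cbB`, the range of `B` inside the support of `Δ(η)` and the support of `B` inside the
support of `Δ(ξ)`. -/
structure IsCbBFactorization {n : ℕ} (X : Matrix (Fin n) (Fin n) ℂ)
    (η : Fin n → ℝ) (B : Matrix (Fin n) (Fin n) ℂ) (ξ : Fin n → ℝ) : Prop where
  nonneg_left : ∀ i, 0 ≤ η i
  nonneg_right : ∀ j, 0 ≤ ξ j
  unit_left : ∑ i, η i ^ 2 = 1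
  unit_right : ∑ j, ξ j ^ 2 = 1
  factor : X = diagMat η * B * diagMat ξ
  norm_eq : opNorm B = cbBNorm X
  range_le : ∀ i j, η i = 0 → B i j = 0
  support_le : ∀ i j, ξ j = 0 → B i j = 0

/-- A self-adjoint Schur factorization `Y = E S E`: `E ≥ 0`, `diag (E²) ≤ ‖Y‖_S I`, and `S` is a
self-adjoint isometry. -/
structure IsSelfAdjointSchurFactorization {n : ℕ} (Y E S : Matrix (Fin n) (Fin n) ℂ) : Prop where
  posSemidef : E.PosSemidef
  diag_le : ∀ j, ((E * E) j j).re ≤ schurNorm Y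
  selfAdjoint : S.IsHermitian
  isometry : Sᴴ * S = 1
  factor : Y = E * S * E

/-- The projection `F = (I + S)/2` onto the eigenspace of `S` for the eigenvalue `1`. With
`G = (I - S)/2` one has `S = F - G`. -/
def posProj {n : ℕ} (S : Matrix (Fin n) (Fin n) ℂ) : Matrix (Fin n) (Fin n) ℂ :=
  (1 / 2 : ℂ) • (1 + S)

/-- The projection `G = (I - S)/2` onto the eigenspace of `S` for the eigenvalue `-1`. -/
def negProj {n : ℕ} (S : Matrix (Fin n) (Fin n) ℂ) : Matrix (Fin n) (Fin n) ℂ :=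
  (1 / 2 : ℂ) • (1 - S)

/-- `μ` records a spectral decomposition `A = ∑ μ_s P_{ξ_s}` with `(ξ_s)` a finite orthonormal
set and all `μ_s > 0`; the variables of the remaining unit vectors are zero. -/
structure IsSpectralDecomposition {n : ℕ} (A : Matrix (Fin n) (Fin n) ℂ)
    (μ : UnitVec n → ℝ) : Prop where
  nonneg : ∀ ξ, 0 ≤ μ ξ
  finite : (Function.support μ).Finite
  orthonormal : Orthonormal ℂ
    fun ξ : Function.support μ => ((ξ : UnitVec n) : EuclideanSpace ℂ (Fin n))
  eq_sum : A = projSum μ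

end

end SchurLP

/-!
With `M = ∑ μ_ξ P_ξ` and `N = ∑ ν_η P_η`, the dual program maximizes `Tr ((M - N) X)` over positive
semidefinite `M`, `N` with `diag (M + N) ≤ 1`. The block matrix `[M + N, M - N; M - N, M + N]` is
positive semidefinite, so `‖M - N‖_S ≤ max_j (M + N)ⱼⱼ` and the dual values are at most `‖X‖_cbB`.
Primal feasibility says `-Δ(λ) ≤ X ≤ Δ(λ)`, that is `X = Δ(√λ) T Δ(√λ)` with `‖T‖ ≤ 1`, whence
`‖X‖_cbB ≤ ∑ λⱼ`. The dual maximum is attained by compactness, and separating the convex set of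
dual slacks from the open negative orthant gives a primal solution of the same value.

For two cbB-factorizations `Δ(η) B Δ(ξ) = Δ(η') B' Δ(ξ')` of `X`, the Heinz inequality shows that
`X` also factors through `Δ(√(η η'))` and `Δ(√(ξ ξ'))` with a middle factor of norm at most
`‖X‖_cbB`. This forces `∑ ηᵢ η'ᵢ = ∑ ξⱼ ξ'ⱼ = 1`, so `η = η'` and `ξ = ξ'`.
-/

namespace SchurLP

open Matrix
open scoped MatrixOrder Matrix.Norms.L2Operator

section CStarAlgebra

variable {A : Type*} [CStarAlgebra A]

lemma norm_mul_le_norm_mul_comm {a b : A} (h : IsSelfAdjoint (a * b)) : ‖a * b‖ ≤ ‖b * a‖ := by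
  nontriviality A
  have hspec : spectralRadius ℂ (a * b) ≤ spectralRadius ℂ (b * a) := by
    refine iSup₂_le fun k hk => ?_
    rcases eq_or_ne k 0 with rfl | hk0
    · simp
    · have hk' : k ∈ spectrum ℂ (b * a) :=
        ((spectrum.nonzero_mul_comm (𝕜 := ℂ) a b).subset ⟨hk, hk0⟩).1
      exact le_iSup₂ (f := fun (k : ℂ) (_ : k ∈ spectrum ℂ (b * a)) => (‖k‖₊ : ENNReal)) k hk'
  rw [h.spectralRadius_eq_nnnorm] at hspec
  exact_mod_cast hspec.trans (spectrum.spectralRadius_le_nnnorm (b * a))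

/-- The Heinz inequality at the exponent `1 / 2`. -/
lemma norm_mul_mul_sq_le {a c : A} (ha : IsSelfAdjoint a) (hc : IsSelfAdjoint c) (b : A) :
    ‖a * b * c‖ ^ 2 ≤ ‖b‖ * ‖a * a * b * (c * c)‖ := by
  have hstar : star (a * b * c) * (a * b * c) = c * (star b * (a * a * b * c)) := by
    simp only [star_mul, ha.star_eq, hc.star_eq, mul_assoc]
  calc ‖a * b * c‖ ^ 2 = ‖c * (star b * (a * a * b * c))‖ := by
        rw [sq, ← CStarRing.norm_star_mul_self, hstar]
    _ ≤ ‖star b * (a * a * b * c) * c‖ :=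
        norm_mul_le_norm_mul_comm (hstar ▸ IsSelfAdjoint.star_mul_self _)
    _ = ‖star b * (a * a * b * (c * c))‖ := by simp only [mul_assoc]
    _ ≤ ‖b‖ * ‖a * a * b * (c * c)‖ := by
        simpa only [norm_star] using norm_mul_le (star b) (a * a * b * (c * c))

variable [PartialOrder A] [StarOrderedRing A]

lemma norm_le_one_of_mem_Icc {a : A} (ha : a ∈ Set.Icc (-1) 1) : ‖a‖ ≤ 1 := by
  have hsa : IsSelfAdjoint a := by
    simpa only [sub_sub_cancel] using (IsSelfAdjoint.one A).sub (.of_nonneg (sub_nonneg.2 ha.2))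
  have hcomm : Commute (1 - a) (a - -1) := by
    simp only [Commute, SemiconjBy]; noncomm_ring
  have hmul : (1 - a) * (a - -1) = 1 - a * a := by noncomm_ring
  have hsq : a * a ≤ 1 :=
    sub_nonneg.1 (hmul ▸ hcomm.mul_nonneg (sub_nonneg.2 ha.2) (sub_nonneg.2 ha.1))
  rw [← abs_of_nonneg (norm_nonneg a), ← sq_le_one_iff_abs_le_one, sq,
    ← CStarRing.norm_star_mul_self, hsa.star_eq]
  exact (CStarAlgebra.norm_le_one_iff_of_nonneg _ hsa.mul_self_nonneg).2 hsq

end CStarAlgebra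

section Matrix

lemma posSemidef_fromBlocks_add_sub {ι : Type*} [Finite ι] {M N : Matrix ι ι ℂ}
    (hM : M.PosSemidef) (hN : N.PosSemidef) :
    (fromBlocks (M + N) (M - N) (M - N)ᴴ (M + N)).PosSemidef := by
  classical
  cases nonempty_fintype ι
  let I : Matrix ι ι ℂ := 1
  have h := (hM.conjTranspose_mul_mul_same (fromCols I I)).add
    (hN.conjTranspose_mul_mul_same (fromCols I (-I)))
  rw [conjTranspose_fromCols_eq_fromRows_conjTranspose,
    conjTranspose_fromCols_eq_fromRows_conjTranspose] at h
  simpa [fromRows_mul, mul_fromCols, fromRows_fromCols_eq_fromBlocks, fromBlocks_add, hM.1.eq,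
    hN.1.eq, sub_eq_add_neg, I] using h

lemma apply_eq_zero_of_posSemidef {ι : Type*} [Finite ι] {A : Matrix ι ι ℂ}
    (hA : A.PosSemidef) {i : ι} (hi : A i i = 0) (j : ι) : A i j = 0 := by
  classical
  cases nonempty_fintype ι
  have hcol : A *ᵥ Pi.single i 1 = 0 := by
    rw [← hA.dotProduct_mulVec_zero_iff]
    simp [hi]
  rw [← hA.1.apply, star_eq_zero]
  simpa using congr_fun hcol j

variable {ι : Type*} [Fintype ι] [DecidableEq ι]

lemma norm_le_one_iff_posSemidef_fromBlocks (A : Matrix ι ι ℂ) :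
    ‖A‖ ≤ 1 ↔ (fromBlocks 1 A Aᴴ 1).PosSemidef := by
  have := invertibleOne (α := Matrix ι ι ℂ)
  rw [PosDef.fromBlocks₁₁ A 1 PosDef.one, inv_one, mul_one, ← nonneg_iff_posSemidef, sub_nonneg,
    ← star_eq_conjTranspose, ← CStarAlgebra.norm_le_one_iff_of_nonneg _ (star_mul_self_nonneg A),
    CStarRing.norm_star_mul_self, ← sq, sq_le_one_iff_abs_le_one, abs_norm]

/-- Adding a diagonal matrix to the Schur product of `[P Y; Y* Q]` and `[1 A; A* 1]` gives
`[c Y∘A; (Y∘A)* c]`. -/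
lemma norm_hadamard_le_of_posSemidef_fromBlocks {P Y Q A : Matrix ι ι ℂ} {c : ℝ}
    (h : (fromBlocks P Y Yᴴ Q).PosSemidef) (hc : 0 ≤ c) (hP : ∀ j, P j j ≤ c)
    (hQ : ∀ j, Q j j ≤ c) (hA : ‖A‖ ≤ 1) : ‖Y ⊙ A‖ ≤ c := by
  refine le_of_forall_gt_imp_ge_of_dense fun r hr => ?_
  have hr0 : 0 < r := hc.trans_lt hr
  have hcr : (c : ℂ) ≤ r := by exact_mod_cast hr.le
  have hdiag : (diagonal (Sum.elim (fun j => r - P j j) (fun j => r - Q j j))).PosSemidef :=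
    .diagonal fun j => by cases j <;> simp [(hP _).trans hcr, (hQ _).trans hcr]
  have hsum := (h.hadamard ((norm_le_one_iff_posSemidef_fromBlocks A).1 hA)).add hdiag
  have hblocks : (r⁻¹ : ℂ) • (fromBlocks P Y Yᴴ Q ⊙ fromBlocks 1 A Aᴴ 1 +
      diagonal (Sum.elim (fun j => r - P j j) (fun j => r - Q j j))) =
      fromBlocks 1 ((r⁻¹ : ℂ) • (Y ⊙ A)) ((r⁻¹ : ℂ) • (Y ⊙ A))ᴴ 1 := by
    ext (i | i) (j | j) <;> obtain rfl | hij := eq_or_ne i j <;> simp [hr0.ne', *]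
  have hscaled : ‖(r⁻¹ : ℂ) • (Y ⊙ A)‖ ≤ 1 := by
    rw [norm_le_one_iff_posSemidef_fromBlocks, ← hblocks]
    exact hsum.smul (by exact_mod_cast inv_nonneg.2 hr0.le)
  rwa [norm_smul, norm_inv, Complex.norm_real, Real.norm_of_nonneg hr0.le,
    inv_mul_le_iff₀ hr0, mul_one] at hscaled

lemma norm_map_star_le (A : Matrix ι ι ℂ) : ‖A.map star‖ ≤ ‖A‖ := by
  refine ContinuousLinearMap.opNorm_le_bound _ (norm_nonneg A) fun x => ?_
  have hmul : A.map star *ᵥ x.ofLp = star (A *ᵥ star x.ofLp) := by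
    ext i
    simp [mulVec, dotProduct]
  have h := l2_opNorm_mulVec A (WithLp.toLp 2 (star x.ofLp))
  simp only [EuclideanSpace.norm_eq] at h ⊢
  change √(∑ i, ‖(A.map star *ᵥ x.ofLp) i‖ ^ 2) ≤ _
  rw [hmul]
  simpa using h

lemma norm_vecMul_dotProduct_le (A : Matrix ι ι ℂ) (v w : ι → ℂ) :
    ‖v ᵥ* A ⬝ᵥ w‖ ≤ ‖A‖ * (‖WithLp.toLp 2 v‖ * ‖WithLp.toLp 2 w‖) := by
  have hinner : v ᵥ* A ⬝ᵥ w = inner ℂ (WithLp.toLp 2 (star v)) (WithLp.toLp 2 (A *ᵥ w)) := by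
    rw [EuclideanSpace.inner_toLp_toLp, star_star, ← dotProduct_mulVec, dotProduct_comm]
  have hv : ‖WithLp.toLp 2 (star v)‖ = ‖WithLp.toLp 2 v‖ := by simp [EuclideanSpace.norm_eq]
  calc ‖v ᵥ* A ⬝ᵥ w‖ ≤ ‖WithLp.toLp 2 v‖ * ‖WithLp.toLp 2 (A *ᵥ w)‖ :=
        hinner ▸ hv ▸ norm_inner_le_norm _ _
    _ ≤ ‖WithLp.toLp 2 v‖ * (‖A‖ * ‖WithLp.toLp 2 w‖) := by
        gcongr
        exact l2_opNorm_mulVec A (WithLp.toLp 2 w)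
    _ = ‖A‖ * (‖WithLp.toLp 2 v‖ * ‖WithLp.toLp 2 w‖) := by ring

end Matrix

section SchurNorm

variable {n : ℕ}

lemma opNorm_eq_norm (A : Matrix (Fin n) (Fin n) ℂ) : opNorm A = ‖A‖ := rfl

/-- The Schur multiplier `A ↦ Y ∘ A` as a bounded operator, so that `schurNorm Y` is an instance
of the operator norm of the library. -/
noncomputable def schurMultiplier (Y : Matrix (Fin n) (Fin n) ℂ) :
    Matrix (Fin n) (Fin n) ℂ →L[ℂ] Matrix (Fin n) (Fin n) ℂ :=
  LinearMap.toContinuousLinearMap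
    { toFun A := Y ⊙ A
      map_add' A B := hadamard_add Y A B
      map_smul' c A := hadamard_smul Y A c }

lemma schurNorm_eq_norm (Y : Matrix (Fin n) (Fin n) ℂ) : schurNorm Y = ‖schurMultiplier Y‖ := by
  rw [← ContinuousLinearMap.sSup_unitClosedBall_eq_norm, schurNorm]
  congr 1 with r
  simp only [Set.mem_image, mem_closedBall_zero_iff, opNorm_eq_norm, Set.mem_ofPred_eq, eq_comm]
  rfl

lemma norm_hadamard_le (Y A : Matrix (Fin n) (Fin n) ℂ) : ‖Y ⊙ A‖ ≤ schurNorm Y * ‖A‖ :=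
  schurNorm_eq_norm Y ▸ (schurMultiplier Y).le_opNorm A

lemma schurNorm_nonneg (Y : Matrix (Fin n) (Fin n) ℂ) : 0 ≤ schurNorm Y :=
  schurNorm_eq_norm Y ▸ norm_nonneg _

lemma schurNorm_smul (c : ℂ) (Y : Matrix (Fin n) (Fin n) ℂ) :
    schurNorm (c • Y) = ‖c‖ * schurNorm Y := by
  rw [schurNorm_eq_norm, schurNorm_eq_norm, ← norm_smul]
  congr 1 with A
  simp [schurMultiplier]

lemma schurNorm_eq_zero {Y : Matrix (Fin n) (Fin n) ℂ} : schurNorm Y = 0 ↔ Y = 0 := by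
  refine ⟨fun h => ?_, fun h => ?_⟩
  · simpa [h] using norm_hadamard_le Y (of 1)
  · simpa [h] using schurNorm_smul 0 (0 : Matrix (Fin n) (Fin n) ℂ)

lemma norm_apply_self_le_schurNorm (Y : Matrix (Fin n) (Fin n) ℂ) (j : Fin n) :
    ‖Y j j‖ ≤ schurNorm Y := by
  have : Nonempty (Fin n) := ⟨j⟩
  calc ‖Y j j‖ ≤ ‖Y.diag‖ := norm_le_pi_norm Y.diag j
    _ = ‖Y ⊙ 1‖ := by rw [hadamard_one, l2_opNorm_diagonal]
    _ ≤ schurNorm Y := by simpa using norm_hadamard_le Y 1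

lemma schurNorm_le_of_posSemidef_fromBlocks {P Y Q : Matrix (Fin n) (Fin n) ℂ} {c : ℝ}
    (h : (fromBlocks P Y Yᴴ Q).PosSemidef) (hc : 0 ≤ c) (hP : ∀ j, P j j ≤ c)
    (hQ : ∀ j, Q j j ≤ c) : schurNorm Y ≤ c := by
  refine csSup_le ⟨0, 0, by simp [opNorm]⟩ ?_
  rintro _ ⟨A, hA, rfl⟩
  exact norm_hadamard_le_of_posSemidef_fromBlocks h hc hP hQ hA

lemma schurNorm_sub_le {M N : Matrix (Fin n) (Fin n) ℂ} (hM : M.PosSemidef) (hN : N.PosSemidef)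
    {c : ℝ} (hc : 0 ≤ c) (hdiag : ∀ j, ((M + N) j j).re ≤ c) : schurNorm (M - N) ≤ c := by
  have hle (j : Fin n) : (M + N) j j ≤ c :=
    Complex.le_def.2 ⟨hdiag j, (Complex.nonneg_iff.1 (hM.add hN).diag_nonneg).2.symm⟩
  exact schurNorm_le_of_posSemidef_fromBlocks (posSemidef_fromBlocks_add_sub hM hN) hc hle hle

lemma norm_trace_conjTranspose_mul_le (Y T : Matrix (Fin n) (Fin n) ℂ) (a b : Fin n → ℝ) :
    ‖(Yᴴ * (diagMat a * T * diagMat b)).trace‖ ≤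
      schurNorm Y * (‖T‖ * (√(∑ i, a i ^ 2) * √(∑ i, b i ^ 2))) := by
  have htrace : (Yᴴ * (diagMat a * T * diagMat b)).trace =
      (fun i => (a i : ℂ)) ᵥ* (Y ⊙ T.map star).map star ⬝ᵥ fun j => (b j : ℂ) := by
    have hmap : (Y ⊙ T.map star).map star = T ⊙ Y.map star := by
      ext; simp [mul_comm]
    rw [hmap, dotProduct_vecMul_hadamard, trace_mul_comm, transpose_mul, diagonal_transpose,
      mul_assoc (diagMat a * T)]
    rfl
  have hnorm (a : Fin n → ℝ) : ‖WithLp.toLp 2 fun i => (a i : ℂ)‖ = √(∑ i, a i ^ 2) := by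
    simp [EuclideanSpace.norm_eq]
  have hmul : ‖(Y ⊙ T.map star).map star‖ ≤ schurNorm Y * ‖T‖ :=
    calc _ ≤ ‖Y ⊙ T.map star‖ := norm_map_star_le _
      _ ≤ schurNorm Y * ‖T.map star‖ := norm_hadamard_le _ _
      _ ≤ schurNorm Y * ‖T‖ := by gcongr; exacts [schurNorm_nonneg Y, norm_map_star_le T]
  rw [htrace, ← mul_assoc, ← hnorm, ← hnorm]
  exact (norm_vecMul_dotProduct_le _ _ _).trans (by gcongr)

lemma cbBNorm_le (T : Matrix (Fin n) (Fin n) ℂ) (a b : Fin n → ℝ) :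
    cbBNorm (diagMat a * T * diagMat b) ≤ ‖T‖ * (√(∑ i, a i ^ 2) * √(∑ i, b i ^ 2)) := by
  refine csSup_le ⟨_, 0, by simp [schurNorm_eq_zero.2], rfl⟩ ?_
  rintro _ ⟨Y, hY, rfl⟩
  exact (norm_trace_conjTranspose_mul_le Y T a b).trans (mul_le_of_le_one_left (by positivity) hY)

lemma norm_trace_le_cbBNorm {Y : Matrix (Fin n) (Fin n) ℂ} (hY : schurNorm Y ≤ 1)
    (X : Matrix (Fin n) (Fin n) ℂ) : ‖(Yᴴ * X).trace‖ ≤ cbBNorm X := by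
  refine le_csSup ⟨‖X‖ * (√(∑ _ : Fin n, 1 ^ 2) * √(∑ _ : Fin n, 1 ^ 2)), ?_⟩ ⟨Y, hY, rfl⟩
  rintro _ ⟨Y, hY, rfl⟩
  have h := norm_trace_conjTranspose_mul_le Y X (fun _ => 1) (fun _ => 1)
  have hone : diagMat (fun _ : Fin n => (1 : ℝ)) = 1 := by simp [diagMat]
  rw [hone, one_mul, mul_one] at h
  exact h.trans (mul_le_of_le_one_left (by positivity) hY)

lemma cbBNorm_nonneg (X : Matrix (Fin n) (Fin n) ℂ) : 0 ≤ cbBNorm X :=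
  (norm_nonneg _).trans (norm_trace_le_cbBNorm (Y := 0) (by simp [schurNorm_eq_zero.2]) X)

lemma norm_trace_le_schurNorm_mul_cbBNorm (Y X : Matrix (Fin n) (Fin n) ℂ) :
    ‖(Yᴴ * X).trace‖ ≤ schurNorm Y * cbBNorm X := by
  obtain rfl | hY := eq_or_ne Y 0
  · simp [schurNorm_eq_zero.2]
  · have hpos : 0 < schurNorm Y := (schurNorm_nonneg Y).lt_of_ne' (schurNorm_eq_zero.not.2 hY)
    have h := norm_trace_le_cbBNorm (Y := ((schurNorm Y)⁻¹ : ℂ) • Y)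
      (by simp [schurNorm_smul, abs_of_pos hpos, hpos.ne']) X
    rwa [conjTranspose_smul, smul_mul, trace_smul, norm_smul, norm_star, norm_inv,
      Complex.norm_real, Real.norm_of_nonneg hpos.le, inv_mul_le_iff₀ hpos] at h

lemma cbBNorm_zero : cbBNorm (0 : Matrix (Fin n) (Fin n) ℂ) = 0 :=
  (cbBNorm_nonneg 0).antisymm' (by simpa using cbBNorm_le (0 : Matrix (Fin n) (Fin n) ℂ) 0 0)

lemma cbBNorm_pos {X : Matrix (Fin n) (Fin n) ℂ} (hX : X ≠ 0) : 0 < cbBNorm X := by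
  refine (cbBNorm_nonneg X).lt_of_ne' fun h => hX ?_
  rw [← trace_conjTranspose_mul_self_eq_zero_iff, ← norm_le_zero_iff]
  simpa only [h, mul_zero] using norm_trace_le_schurNorm_mul_cbBNorm X X

end SchurNorm

section Primal

variable {n : ℕ}

lemma exists_eq_smul_coord {v : Fin n → ℂ} (hv : v ≠ 0) :
    ∃ (r : ℝ) (ξ : UnitVec n), v = (r : ℂ) • ξ.coord := by
  refine ⟨‖WithLp.toLp 2 v‖, ⟨(‖WithLp.toLp 2 v‖⁻¹ : ℂ) • WithLp.toLp 2 v, ?_⟩, ?_⟩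
  · simp [norm_smul, hv]
  · simp [UnitVec.coord, smul_smul, hv]

lemma posSemidef_iff_quadForm_nonneg {A : Matrix (Fin n) (Fin n) ℂ} (hA : A.IsHermitian) :
    A.PosSemidef ↔ ∀ ξ : UnitVec n, 0 ≤ quadForm A ξ := by
  refine ⟨fun h ξ => (Complex.nonneg_iff.1 (h.dotProduct_mulVec_nonneg ξ.coord)).1, fun h =>
    .of_dotProduct_mulVec_nonneg hA fun v => ?_⟩
  obtain rfl | hv := eq_or_ne v 0
  · simp
  · obtain ⟨r, ξ, rfl⟩ := exists_eq_smul_coord hv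
    have hquad : star ξ.coord ⬝ᵥ A *ᵥ ξ.coord = (quadForm A ξ : ℂ) :=
      Complex.ext rfl (hA.im_star_dotProduct_mulVec_self ξ.coord)
    have hscale : star ((r : ℂ) • ξ.coord) ⬝ᵥ A *ᵥ ((r : ℂ) • ξ.coord) =
        ((r * r * quadForm A ξ : ℝ) : ℂ) := by
      simp [mulVec_smul, hquad, mul_assoc]
    rw [hscale]
    exact_mod_cast mul_nonneg (mul_self_nonneg r) (h ξ)

lemma quadForm_add (A B : Matrix (Fin n) (Fin n) ℂ) (ξ : UnitVec n) :
    quadForm (A + B) ξ = quadForm A ξ + quadForm B ξ := by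
  simp [quadForm, add_mulVec]

lemma quadForm_sub (A B : Matrix (Fin n) (Fin n) ℂ) (ξ : UnitVec n) :
    quadForm (A - B) ξ = quadForm A ξ - quadForm B ξ := by
  simp [quadForm, sub_mulVec]

lemma quadForm_diagMat (l : Fin n → ℝ) (ξ : UnitVec n) :
    quadForm (diagMat l) ξ = ∑ j, l j * ‖ξ.coord j‖ ^ 2 := by
  simp only [quadForm, dotProduct, diagMat, mulVec_diagonal, Complex.re_sum, Pi.star_apply]
  refine Finset.sum_congr rfl fun j _ => ?_
  rw [mul_left_comm, Complex.re_ofReal_mul, Complex.star_def, ← Complex.normSq_eq_conj_mul_self,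
    Complex.ofReal_re, Complex.normSq_eq_norm_sq]

lemma isHermitian_diagMat (l : Fin n → ℝ) : (diagMat l).IsHermitian :=
  isHermitian_diagonal_of_self_adjoint _ (by ext; simp)

lemma diagMat_mul_mul_diagMat_apply (a b : Fin n → ℝ) (T : Matrix (Fin n) (Fin n) ℂ)
    (i j : Fin n) : (diagMat a * T * diagMat b) i j = a i * T i j * b j := by
  simp [diagMat]

lemma diagMat_mul_mul_diagMat_mono {A B : Matrix (Fin n) (Fin n) ℂ} (h : A ≤ B)
    (a : Fin n → ℝ) : diagMat a * A * diagMat a ≤ diagMat a * B * diagMat a :=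
  (show IsSelfAdjoint (diagMat a) from isHermitian_diagMat a).conjugate_le_conjugate h

lemma diagMat_le_diagMat {a b : Fin n → ℝ} (h : ∀ j, a j ≤ b j) : diagMat a ≤ diagMat b := by
  rw [le_iff, diagMat, diagMat, diagonal_sub]
  exact .diagonal fun j => sub_nonneg.2 (Complex.real_le_real.2 (h j))

variable {X : Matrix (Fin n) (Fin n) ℂ} {l : Fin n → ℝ}

lemma primalFeasible_iff_mem_Icc (hX : X.IsHermitian) :
    PrimalFeasible X l ↔ X ∈ Set.Icc (-diagMat l) (diagMat l) := by
  have hl := isHermitian_diagMat l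
  have hupper : X ≤ diagMat l ↔ ∀ ξ, quadForm X ξ ≤ ∑ j, l j * ‖ξ.coord j‖ ^ 2 := by
    rw [le_iff, posSemidef_iff_quadForm_nonneg (hl.sub hX)]
    simp only [quadForm_sub, quadForm_diagMat, sub_nonneg]
  have hlower : -diagMat l ≤ X ↔ ∀ ξ, -quadForm X ξ ≤ ∑ j, l j * ‖ξ.coord j‖ ^ 2 := by
    rw [le_iff, sub_neg_eq_add, posSemidef_iff_quadForm_nonneg (hX.add hl)]
    simp only [quadForm_add, quadForm_diagMat, neg_le_iff_add_nonneg']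
  rw [Set.mem_Icc, hupper, hlower]
  refine ⟨fun h => ⟨h.lower, h.upper⟩, fun h => ⟨fun j => ?_, h.2, h.1⟩⟩
  have hsum := (le_iff.1 (hupper.2 h.2)).add (le_iff.1 (hlower.2 h.1))
  have hj := (Complex.nonneg_iff.1 (hsum.diag_nonneg (i := j))).1
  simp only [diagMat, Matrix.add_apply, Matrix.sub_apply, diagonal_apply_eq, sub_neg_eq_add,
    Complex.add_re, Complex.sub_re, Complex.ofReal_re] at hj
  linarith

lemma apply_eq_zero_of_mem_Icc (hX : X ∈ Set.Icc (-diagMat l) (diagMat l)) {i : Fin n}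
    (hi : l i = 0) (j : Fin n) : X i j = 0 := by
  have hupper := le_iff.1 hX.2
  have hlower := le_iff.1 hX.1
  have hXi : X i i = 0 := le_antisymm
    (by simpa [diagMat, hi] using hupper.diag_nonneg (i := i))
    (by simpa [diagMat, hi] using hlower.diag_nonneg (i := i))
  obtain rfl | hij := eq_or_ne i j
  · exact hXi
  · have hdiag : (diagMat l - X) i i = 0 := by simp [diagMat, hi, hXi]
    simpa [diagMat, hij] using apply_eq_zero_of_posSemidef hupper hdiag j

/-- The matrix `Δ(√l)⁻¹ X Δ(√l)⁻¹`. Rows and columns of `X` where `l` vanishes are replaced by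
zero, because `(√0)⁻¹ = 0`. -/
noncomputable def rescale (X : Matrix (Fin n) (Fin n) ℂ) (l : Fin n → ℝ) :
    Matrix (Fin n) (Fin n) ℂ :=
  diagMat (fun j => (√(l j))⁻¹) * X * diagMat fun j => (√(l j))⁻¹

lemma rescale_apply (X : Matrix (Fin n) (Fin n) ℂ) (l : Fin n → ℝ) (i j : Fin n) :
    rescale X l i j = (√(l i))⁻¹ * X i j * (√(l j))⁻¹ := by
  simp [rescale, diagMat_mul_mul_diagMat_apply]

lemma PrimalFeasible.eq_diagMat_mul_rescale_mul_diagMat (hX : X.IsHermitian)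
    (h : PrimalFeasible X l) :
    X = diagMat (fun j => √(l j)) * rescale X l * diagMat fun j => √(l j) := by
  have hIcc := (primalFeasible_iff_mem_Icc hX).1 h
  ext i j
  rw [diagMat_mul_mul_diagMat_apply, rescale_apply]
  obtain hi | hi := (h.nonneg i).eq_or_lt'
  · simp [hi, apply_eq_zero_of_mem_Icc hIcc hi]
  obtain hj | hj := (h.nonneg j).eq_or_lt'
  · simp [hj, ← hX.apply i j, apply_eq_zero_of_mem_Icc hIcc hj]
  · have hi' : (√(l i) : ℂ) ≠ 0 := Complex.ofReal_ne_zero.2 (Real.sqrt_pos.2 hi).ne'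
    have hj' : (√(l j) : ℂ) ≠ 0 := Complex.ofReal_ne_zero.2 (Real.sqrt_pos.2 hj).ne'
    rw [Complex.ofReal_inv, Complex.ofReal_inv, mul_assoc, mul_assoc, mul_assoc,
      inv_mul_cancel₀ hj', mul_one, mul_inv_cancel_left₀ hi']

lemma PrimalFeasible.norm_rescale_le_one (hX : X.IsHermitian) (h : PrimalFeasible X l) :
    ‖rescale X l‖ ≤ 1 := by
  have hIcc := (primalFeasible_iff_mem_Icc hX).1 h
  have hle : diagMat (fun j => (√(l j))⁻¹) * diagMat l * diagMat (fun j => (√(l j))⁻¹) ≤ 1 := by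
    have hone : diagMat (fun _ : Fin n => (1 : ℝ)) = 1 := by simp [diagMat]
    have hmul (j : Fin n) : (√(l j))⁻¹ * l j * (√(l j))⁻¹ ≤ 1 := by
      rw [mul_right_comm, ← mul_inv, Real.mul_self_sqrt (h.nonneg j)]
      exact inv_mul_le_one
    simpa [diagMat, hone] using diagMat_le_diagMat hmul
  refine norm_le_one_of_mem_Icc ⟨?_, (diagMat_mul_mul_diagMat_mono hIcc.2 _).trans hle⟩
  refine (neg_le_neg hle).trans ?_
  simpa only [rescale, mul_neg, neg_mul] using
    diagMat_mul_mul_diagMat_mono hIcc.1 fun j => (√(l j))⁻¹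

lemma PrimalFeasible.cbBNorm_le_norm_rescale_mul_sum (hX : X.IsHermitian)
    (h : PrimalFeasible X l) : cbBNorm X ≤ ‖rescale X l‖ * ∑ j, l j := by
  have hsum : ∑ j, √(l j) ^ 2 = ∑ j, l j :=
    Finset.sum_congr rfl fun j _ => Real.sq_sqrt (h.nonneg j)
  have hle := cbBNorm_le (rescale X l) (fun j => √(l j)) fun j => √(l j)
  rwa [← h.eq_diagMat_mul_rescale_mul_diagMat hX, hsum,
    Real.mul_self_sqrt (Finset.sum_nonneg fun j _ => h.nonneg j)] at hle

lemma PrimalFeasible.cbBNorm_le_sum (hX : X.IsHermitian) (h : PrimalFeasible X l) :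
    cbBNorm X ≤ ∑ j, l j :=
  (h.cbBNorm_le_norm_rescale_mul_sum hX).trans <|
    mul_le_of_le_one_left (Finset.sum_nonneg fun j _ => h.nonneg j) (h.norm_rescale_le_one hX)

lemma primalFeasible_diagMat_mul_mul_diagMat {B : Matrix (Fin n) (Fin n) ℂ}
    (hB : B.IsHermitian) (ξ : Fin n → ℝ) :
    PrimalFeasible (diagMat ξ * B * diagMat ξ) fun j => ‖B‖ * ξ j ^ 2 := by
  have hconj : diagMat ξ * algebraMap ℝ (Matrix (Fin n) (Fin n) ℂ) ‖B‖ * diagMat ξ =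
      diagMat fun j => ‖B‖ * ξ j ^ 2 := by
    ext i j
    rw [diagMat_mul_mul_diagMat_apply, algebraMap_matrix_apply, diagMat]
    obtain rfl | hij := eq_or_ne i j
    · simp only [↓reduceIte, Complex.coe_algebraMap, Complex.ofReal_mul, Complex.ofReal_pow,
        diagonal_apply_eq]
      ring
    · simp [hij]
  have hsa : IsSelfAdjoint B := hB
  have hherm : (diagMat ξ * B * diagMat ξ).IsHermitian := by
    simpa only [(isHermitian_diagMat ξ).eq] using isHermitian_mul_mul_conjTranspose (diagMat ξ) hB
  rw [primalFeasible_iff_mem_Icc hherm, ← hconj]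
  refine ⟨?_, diagMat_mul_mul_diagMat_mono hsa.le_algebraMap_norm_self ξ⟩
  simpa only [mul_neg, neg_mul] using
    diagMat_mul_mul_diagMat_mono hsa.neg_algebraMap_norm_le_self ξ

end Primal

section CbBFactorization

variable {n : ℕ}

lemma sum_sub_sq_of_unit {ι : Type*} [Fintype ι] {a b : ι → ℝ} (ha : ∑ i, a i ^ 2 = 1)
    (hb : ∑ i, b i ^ 2 = 1) : ∑ i, (a i - b i) ^ 2 = 2 - 2 * ∑ i, a i * b i := by
  simp only [sub_sq, Finset.sum_add_distrib, Finset.sum_sub_distrib, ha, hb, mul_assoc,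
    ← Finset.mul_sum]
  ring

lemma eq_of_two_le_sum_mul_add_sum_mul {ι κ : Type*} [Fintype ι] [Fintype κ] {a a' : ι → ℝ}
    {b b' : κ → ℝ} (ha : ∑ i, a i ^ 2 = 1) (ha' : ∑ i, a' i ^ 2 = 1) (hb : ∑ j, b j ^ 2 = 1)
    (hb' : ∑ j, b' j ^ 2 = 1) (h : 2 ≤ ∑ i, a i * a' i + ∑ j, b j * b' j) :
    a = a' ∧ b = b' := by
  have hasum := sum_sub_sq_of_unit ha ha'
  have hbsum := sum_sub_sq_of_unit hb hb'
  have hanonneg : 0 ≤ ∑ i, (a i - a' i) ^ 2 := Finset.sum_nonneg fun i _ => sq_nonneg _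
  have hbnonneg : 0 ≤ ∑ j, (b j - b' j) ^ 2 := Finset.sum_nonneg fun j _ => sq_nonneg _
  have hazero : ∑ i, (a i - a' i) ^ 2 = 0 := by linarith
  have hbzero : ∑ j, (b j - b' j) ^ 2 = 0 := by linarith
  rw [Finset.sum_eq_zero_iff_of_nonneg fun i _ => sq_nonneg _] at hazero hbzero
  exact ⟨funext fun i => sub_eq_zero.1 (sq_eq_zero_iff.1 (hazero i (Finset.mem_univ i))),
    funext fun j => sub_eq_zero.1 (sq_eq_zero_iff.1 (hbzero j (Finset.mem_univ j)))⟩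

lemma norm_diagMat_sqrt_mul_mul_diagMat_sqrt_sq_le (B : Matrix (Fin n) (Fin n) ℂ)
    {d c : Fin n → ℝ} (hd : ∀ i, 0 ≤ d i) (hc : ∀ j, 0 ≤ c j) :
    ‖diagMat (fun i => √(d i)) * B * diagMat fun j => √(c j)‖ ^ 2 ≤
      ‖B‖ * ‖diagMat d * B * diagMat c‖ := by
  have hsq {a : Fin n → ℝ} (ha : ∀ i, 0 ≤ a i) :
      diagMat (fun i => √(a i)) * diagMat (fun i => √(a i)) = diagMat a := by
    simp [diagMat, ← Complex.ofReal_mul, Real.mul_self_sqrt (ha _)]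
  have hHeinz := norm_mul_mul_sq_le (a := diagMat fun i => √(d i)) (c := diagMat fun j => √(c j))
    (isHermitian_diagMat _) (isHermitian_diagMat _) B
  rwa [hsq hd, hsq hc] at hHeinz

namespace IsCbBFactorization

variable {X B B' : Matrix (Fin n) (Fin n) ℂ} {η ξ η' ξ' : Fin n → ℝ}

lemma apply (h : IsCbBFactorization X η B ξ) (i j : Fin n) : X i j = η i * B i j * ξ j := by
  conv_lhs => rw [h.factor]
  exact diagMat_mul_mul_diagMat_apply ..

lemma conjTranspose (hX : X.IsHermitian) (h : IsCbBFactorization X η B ξ) :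
    IsCbBFactorization X ξ Bᴴ η where
  nonneg_left := h.nonneg_right
  nonneg_right := h.nonneg_left
  unit_left := h.unit_right
  unit_right := h.unit_left
  factor := by
    conv_lhs => rw [← hX.eq, h.factor]
    simp only [conjTranspose_mul, (isHermitian_diagMat _).eq, mul_assoc]
  norm_eq := by rw [opNorm_eq_norm, l2_opNorm_conjTranspose, ← opNorm_eq_norm, h.norm_eq]
  range_le i j hi := by rw [conjTranspose_apply, h.support_le j i hi, star_zero]
  support_le i j hj := by rw [conjTranspose_apply, h.range_le j i hj, star_zero]

lemma eq_diagMat_div_mul_mul_diagMat_div (h : IsCbBFactorization X η B ξ)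
    (h' : IsCbBFactorization X η' B' ξ') :
    B = diagMat (fun i => η' i / η i) * B' * diagMat fun j => ξ' j / ξ j := by
  ext i j
  rw [diagMat_mul_mul_diagMat_apply]
  by_cases hi : η i = 0
  · simp [hi, h.range_le i j hi]
  by_cases hj : ξ j = 0
  · simp [hj, h.support_le i j hj]
  have hi' : (η i : ℂ) ≠ 0 := Complex.ofReal_ne_zero.2 hi
  have hj' : (ξ j : ℂ) ≠ 0 := Complex.ofReal_ne_zero.2 hj
  push_cast
  field_simp
  linear_combination h'.apply i j - h.apply i j

lemma norm_diagMat_sqrt_div_mul_mul_diagMat_sqrt_div_le (h : IsCbBFactorization X η B ξ)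
    (h' : IsCbBFactorization X η' B' ξ') :
    ‖diagMat (fun i => √(η' i / η i)) * B' * diagMat fun j => √(ξ' j / ξ j)‖ ≤ cbBNorm X := by
  have hHeinz := norm_diagMat_sqrt_mul_mul_diagMat_sqrt_sq_le B'
    (fun i => div_nonneg (h'.nonneg_left i) (h.nonneg_left i))
    (fun j => div_nonneg (h'.nonneg_right j) (h.nonneg_right j))
  rw [← h.eq_diagMat_div_mul_mul_diagMat_div h', ← opNorm_eq_norm B, ← opNorm_eq_norm B',
    h.norm_eq, h'.norm_eq, ← sq] at hHeinz
  exact le_of_sq_le_sq hHeinz (cbBNorm_nonneg X)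

lemma eq_diagMat_sqrt_mul_mul_diagMat_sqrt (h : IsCbBFactorization X η B ξ)
    (h' : IsCbBFactorization X η' B' ξ') :
    X = diagMat (fun i => √(η i * η' i)) *
      (diagMat (fun i => √(η' i / η i)) * B' * diagMat fun j => √(ξ' j / ξ j)) *
      diagMat fun j => √(ξ j * ξ' j) := by
  have hsqrt {a b : ℝ} (ha : 0 < a) (hb : 0 ≤ b) : √(a * b) * √(b / a) = b := by
    rw [← Real.sqrt_mul (by positivity), mul_comm a, mul_assoc, mul_div_cancel₀ b ha.ne',
      Real.sqrt_mul_self hb]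
  ext i j
  rw [diagMat_mul_mul_diagMat_apply, diagMat_mul_mul_diagMat_apply]
  obtain hi | hi := (h.nonneg_left i).eq_or_lt'
  · simp [hi, h.apply i j]
  obtain hj | hj := (h.nonneg_right j).eq_or_lt'
  · simp [hj, h.apply i j]
  · conv_lhs => rw [h'.apply i j, ← hsqrt hi (h'.nonneg_left i), ← hsqrt hj (h'.nonneg_right j)]
    push_cast
    ring

lemma two_le_sum_mul_add_sum_mul (hX : X ≠ 0) (h : IsCbBFactorization X η B ξ)
    (h' : IsCbBFactorization X η' B' ξ') : 2 ≤ ∑ i, η i * η' i + ∑ j, ξ j * ξ' j := by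
  have hsum {a b : Fin n → ℝ} (ha : ∀ i, 0 ≤ a i) (hb : ∀ i, 0 ≤ b i) :
      ∑ i, √(a i * b i) ^ 2 = ∑ i, a i * b i :=
    Finset.sum_congr rfl fun i _ => Real.sq_sqrt (mul_nonneg (ha i) (hb i))
  have hnonneg {a b : Fin n → ℝ} (ha : ∀ i, 0 ≤ a i) (hb : ∀ i, 0 ≤ b i) :
      0 ≤ ∑ i, a i * b i := Finset.sum_nonneg fun i _ => mul_nonneg (ha i) (hb i)
  have hle : cbBNorm X ≤ cbBNorm X * (√(∑ i, η i * η' i) * √(∑ j, ξ j * ξ' j)) := by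
    conv_lhs => rw [h.eq_diagMat_sqrt_mul_mul_diagMat_sqrt h']
    refine (cbBNorm_le _ _ _).trans ?_
    rw [hsum h.nonneg_left h'.nonneg_left, hsum h.nonneg_right h'.nonneg_right]
    gcongr
    exact h.norm_diagMat_sqrt_div_mul_mul_diagMat_sqrt_div_le h'
  have hone := (le_mul_iff_one_le_right (cbBNorm_pos hX)).1 hle
  have hleft := Real.sq_sqrt (hnonneg h.nonneg_left h'.nonneg_left)
  have hright := Real.sq_sqrt (hnonneg h.nonneg_right h'.nonneg_right)
  linarith [two_mul_le_add_sq (√(∑ i, η i * η' i)) (√(∑ j, ξ j * ξ' j))]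

theorem unique (hX : X ≠ 0) (h : IsCbBFactorization X η B ξ)
    (h' : IsCbBFactorization X η' B' ξ') : η' = η ∧ B' = B ∧ ξ' = ξ := by
  obtain ⟨rfl, rfl⟩ := eq_of_two_le_sum_mul_add_sum_mul h.unit_left h'.unit_left h.unit_right
    h'.unit_right (h.two_le_sum_mul_add_sum_mul hX h')
  refine ⟨rfl, ?_, rfl⟩
  ext i j
  by_cases hi : η i = 0
  · rw [h.range_le i j hi, h'.range_le i j hi]
  by_cases hj : ξ j = 0
  · rw [h.support_le i j hj, h'.support_le i j hj]
  exact mul_left_cancel₀ (Complex.ofReal_ne_zero.2 hi) (mul_right_cancel₀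
    (Complex.ofReal_ne_zero.2 hj) ((h'.apply i j).symm.trans (h.apply i j)))

lemma isHermitian_and_eq (hX : X.IsHermitian) (h : IsCbBFactorization X η B ξ) :
    B.IsHermitian ∧ X = diagMat ξ * B * diagMat ξ := by
  obtain rfl | hX0 := eq_or_ne X 0
  · have hB : B = 0 := by rw [← norm_eq_zero, ← opNorm_eq_norm, h.norm_eq, cbBNorm_zero]
    simp [hB]
  · obtain ⟨rfl, hB, -⟩ := h.unique hX0 (h.conjTranspose hX)
    exact ⟨hB, h.factor⟩

theorem primalOptimal (hX : X.IsHermitian) (h : IsCbBFactorization X η B ξ) :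
    PrimalOptimal X fun j => cbBNorm X * ξ j ^ 2 := by
  obtain ⟨hB, hfactor⟩ := h.isHermitian_and_eq hX
  refine ⟨?_, fun l hl => ?_⟩
  · have hfeasible := primalFeasible_diagMat_mul_mul_diagMat hB ξ
    rwa [← hfactor, ← opNorm_eq_norm, h.norm_eq] at hfeasible
  · rw [← Finset.mul_sum, h.unit_right, mul_one]
    exact hl.cbBNorm_le_sum hX

end IsCbBFactorization

variable {X : Matrix (Fin n) (Fin n) ℂ} {l : Fin n → ℝ}

lemma PrimalFeasible.norm_rescale_eq_one (hX : X.IsHermitian) (hX0 : X ≠ 0)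
    (h : PrimalFeasible X l) (hsum : ∑ j, l j = cbBNorm X) : ‖rescale X l‖ = 1 := by
  refine (h.norm_rescale_le_one hX).antisymm ?_
  refine (le_mul_iff_one_le_left (cbBNorm_pos hX0)).1 ?_
  rw [← hsum]
  exact hsum.trans_le (h.cbBNorm_le_norm_rescale_mul_sum hX)

lemma PrimalFeasible.isCbBFactorization (hX : X.IsHermitian) (hX0 : X ≠ 0)
    (h : PrimalFeasible X l) (hsum : ∑ j, l j = cbBNorm X) :
    IsCbBFactorization X (fun j => √(l j) / √(cbBNorm X)) ((cbBNorm X : ℂ) • rescale X l)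
      fun j => √(l j) / √(cbBNorm X) := by
  have hK := cbBNorm_pos hX0
  have hunit : ∑ j, (√(l j) / √(cbBNorm X)) ^ 2 = 1 := by
    simp_rw [div_pow, Real.sq_sqrt hK.le, Real.sq_sqrt (h.nonneg _)]
    rw [← Finset.sum_div, hsum, div_self hK.ne']
  have hzero {j : Fin n} (hj : √(l j) / √(cbBNorm X) = 0) : √(l j) = 0 :=
    (div_eq_zero_iff.1 hj).resolve_right (Real.sqrt_pos.2 hK).ne'
  refine ⟨fun _ => by positivity, fun _ => by positivity, hunit, hunit, ?_, ?_, ?_, ?_⟩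
  · conv_lhs => rw [h.eq_diagMat_mul_rescale_mul_diagMat hX]
    ext i j
    have hsqrt : (√(cbBNorm X) : ℂ) ≠ 0 := Complex.ofReal_ne_zero.2 (Real.sqrt_pos.2 hK).ne'
    have hsq : (cbBNorm X : ℂ) = √(cbBNorm X) * √(cbBNorm X) := by
      rw [← Complex.ofReal_mul, Real.mul_self_sqrt hK.le]
    simp only [diagMat_mul_mul_diagMat_apply, Matrix.smul_apply, smul_eq_mul, Complex.ofReal_div]
    field_simp
    rw [hsq]
    ring
  · rw [opNorm_eq_norm, norm_smul, h.norm_rescale_eq_one hX hX0 hsum, mul_one, Complex.norm_real,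
      Real.norm_of_nonneg hK.le]
  · intro i j hi
    simp [rescale_apply, hzero hi]
  · intro i j hj
    simp [rescale_apply, hzero hj]

lemma isCbBFactorization_zero (i : Fin n) :
    IsCbBFactorization (0 : Matrix (Fin n) (Fin n) ℂ) (Pi.single i 1) 0 (Pi.single i 1) where
  nonneg_left j := by rw [Pi.single_apply]; positivity
  nonneg_right j := by rw [Pi.single_apply]; positivity
  unit_left := by simp [Pi.single_apply]
  unit_right := by simp [Pi.single_apply]
  factor := by simp
  norm_eq := by rw [opNorm_eq_norm, norm_zero, cbBNorm_zero]
  range_le _ _ _ := rfl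
  support_le _ _ _ := rfl

end CbBFactorization

section Dual

variable {n : ℕ} {X M N : Matrix (Fin n) (Fin n) ℂ} {l : Fin n → ℝ} {μ ν : UnitVec n → ℝ}

lemma tsum_mul_le_sum_mul_tsum (hμ : ∀ ξ, 0 ≤ μ ξ)
    (hsummable : ∀ j, Summable fun ξ : UnitVec n => μ ξ * ‖ξ.coord j‖ ^ 2) {q : UnitVec n → ℝ}
    (hq : ∀ ξ, |q ξ| ≤ ∑ j, l j * ‖ξ.coord j‖ ^ 2) :
    ∑' ξ, μ ξ * q ξ ≤ ∑ j, l j * ∑' ξ : UnitVec n, μ ξ * ‖ξ.coord j‖ ^ 2 := by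
  have hswap (ξ : UnitVec n) : μ ξ * ∑ j, l j * ‖ξ.coord j‖ ^ 2 =
      ∑ j, l j * (μ ξ * ‖ξ.coord j‖ ^ 2) := by
    simp only [Finset.mul_sum, mul_left_comm]
  have hbound : Summable fun ξ : UnitVec n => μ ξ * ∑ j, l j * ‖ξ.coord j‖ ^ 2 := by
    simpa only [hswap] using summable_sum fun j _ => (hsummable j).mul_left (l j)
  have hsummable_q : Summable fun ξ => μ ξ * q ξ := hbound.of_norm_bounded fun ξ => by
    rw [norm_mul, Real.norm_of_nonneg (hμ ξ)]
    exact mul_le_mul_of_nonneg_left (hq ξ) (hμ ξ)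
  calc ∑' ξ, μ ξ * q ξ
      ≤ ∑' ξ : UnitVec n, μ ξ * ∑ j, l j * ‖ξ.coord j‖ ^ 2 := hsummable_q.tsum_le_tsum
        (fun ξ => mul_le_mul_of_nonneg_left ((le_abs_self _).trans (hq ξ)) (hμ ξ)) hbound
    _ = ∑ j, ∑' ξ : UnitVec n, l j * (μ ξ * ‖ξ.coord j‖ ^ 2) := by
        simp only [hswap]
        exact Summable.tsum_finsetSum fun j _ => (hsummable j).mul_left _
    _ = ∑ j, l j * ∑' ξ : UnitVec n, μ ξ * ‖ξ.coord j‖ ^ 2 := by simp only [tsum_mul_left]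

theorem DualFeasible.dualValue_le_sum (hd : DualFeasible μ ν) (hp : PrimalFeasible X l) :
    dualValue X μ ν ≤ ∑ j, l j := by
  have hquad (ξ : UnitVec n) : |quadForm X ξ| ≤ ∑ j, l j * ‖ξ.coord j‖ ^ 2 :=
    abs_le'.2 ⟨hp.upper ξ, hp.lower ξ⟩
  have hleft := tsum_mul_le_sum_mul_tsum hd.nonneg_left hd.summable_left hquad
  have hright := tsum_mul_le_sum_mul_tsum hd.nonneg_right hd.summable_right
    (q := fun η => -quadForm X η) fun η => (abs_neg _).trans_le (hquad η)
  simp only [mul_neg, tsum_neg] at hright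
  calc dualValue X μ ν
      ≤ ∑ j, l j * (∑' ξ : UnitVec n, μ ξ * ‖ξ.coord j‖ ^ 2 +
          ∑' η : UnitVec n, ν η * ‖η.coord j‖ ^ 2) := by
        simpa only [dualValue, sub_eq_add_neg, mul_add, Finset.sum_add_distrib] using
          add_le_add hleft hright
    _ ≤ ∑ j, l j := Finset.sum_le_sum fun j _ =>
        mul_le_of_le_one_right (hp.nonneg j) (hd.le_one j)

lemma proj_posSemidef (ξ : UnitVec n) : (proj ξ).PosSemidef :=
  posSemidef_vecMulVec_self_star _

lemma proj_apply_self (ξ : UnitVec n) (j : Fin n) : proj ξ j j = ((‖ξ.coord j‖ ^ 2 : ℝ) : ℂ) := by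
  rw [proj, vecMulVec_apply, Pi.star_apply, Complex.star_def, Complex.mul_conj',
    Complex.ofReal_pow]

lemma trace_proj_mul (X : Matrix (Fin n) (Fin n) ℂ) (ξ : UnitVec n) :
    (proj ξ * X).trace = star ξ.coord ⬝ᵥ (X *ᵥ ξ.coord) := by
  rw [trace_mul_comm, proj, mul_vecMulVec, trace_vecMulVec, dotProduct_comm]

lemma trace_proj_mul_eq_quadForm (hX : X.IsHermitian) (ξ : UnitVec n) :
    (proj ξ * X).trace = (quadForm X ξ : ℂ) :=
  (trace_proj_mul X ξ).trans (Complex.ext rfl (hX.im_star_dotProduct_mulVec_self _))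

lemma map_projSum (hμ : (Function.support μ).Finite) (φ : Matrix (Fin n) (Fin n) ℂ →ₗ[ℂ] ℂ)
    {q : UnitVec n → ℝ} (hq : ∀ ξ, φ (proj ξ) = q ξ) :
    φ (projSum μ) = ((∑' ξ, μ ξ * q ξ : ℝ) : ℂ) := by
  have hreal : (Function.support fun ξ => μ ξ * q ξ).Finite :=
    hμ.subset (Function.support_mul_subset_left _ _)
  have hmatrix : (Function.support fun ξ => (μ ξ : ℂ) • proj ξ).Finite :=
    hμ.subset fun ξ hξ hzero => hξ (by simp [hzero])
  calc φ (projSum μ) = ∑ᶠ ξ, φ ((μ ξ : ℂ) • proj ξ) := map_finsum φ hmatrix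
    _ = ∑ᶠ ξ, ((μ ξ * q ξ : ℝ) : ℂ) := by simp [hq]
    _ = ((∑ᶠ ξ, μ ξ * q ξ : ℝ) : ℂ) := (map_finsum Complex.ofRealHom hreal).symm
    _ = ((∑' ξ, μ ξ * q ξ : ℝ) : ℂ) := by rw [tsum_eq_finsum hreal]

lemma projSum_apply_self (hμ : (Function.support μ).Finite) (j : Fin n) :
    projSum μ j j = ((∑' ξ : UnitVec n, μ ξ * ‖ξ.coord j‖ ^ 2 : ℝ) : ℂ) :=
  map_projSum hμ (entryLinearMap ℂ ℂ j j) fun ξ => proj_apply_self ξ j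

lemma trace_projSum_mul (hX : X.IsHermitian) (hμ : (Function.support μ).Finite) :
    (projSum μ * X).trace = ((∑' ξ, μ ξ * quadForm X ξ : ℝ) : ℂ) :=
  map_projSum hμ (traceLinearMap (Fin n) ℂ ℂ ∘ₗ LinearMap.mulRight ℂ X)
    (trace_proj_mul_eq_quadForm hX)

lemma trace_projSum_sub_projSum_mul (hX : X.IsHermitian) (h : FiniteSolution μ ν) :
    ((projSum μ - projSum ν) * X).trace = (dualValue X μ ν : ℂ) := by
  rw [sub_mul, trace_sub, trace_projSum_mul hX h.1, trace_projSum_mul hX h.2, dualValue,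
    Complex.ofReal_sub]

lemma posSemidef_projSum (hμ : ∀ ξ, 0 ≤ μ ξ) : (projSum μ).PosSemidef :=
  nonneg_iff_posSemidef.1 <| finsum_nonneg fun ξ =>
    smul_nonneg (Complex.zero_le_real.2 (hμ ξ)) (proj_posSemidef ξ).nonneg

/-- The feasible pairs `(∑ μ_ξ P_ξ, ∑ ν_η P_η)` of the dual program in matrix form: positive
semidefinite matrices `M`, `N` such that the diagonal of `M + N` is at most `1`. -/
structure DualMatrixFeasible (M N : Matrix (Fin n) (Fin n) ℂ) : Prop where
  posSemidef_left : M.PosSemidef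
  posSemidef_right : N.PosSemidef
  diag_le_one : ∀ j, ((M + N) j j).re ≤ 1

lemma re_projSum_add_projSum_apply_self (h : FiniteSolution μ ν) (j : Fin n) :
    ((projSum μ + projSum ν) j j).re = ∑' ξ : UnitVec n, μ ξ * ‖ξ.coord j‖ ^ 2 +
      ∑' η : UnitVec n, ν η * ‖η.coord j‖ ^ 2 := by
  rw [Matrix.add_apply, projSum_apply_self h.1, projSum_apply_self h.2, ← Complex.ofReal_add,
    Complex.ofReal_re]

lemma DualFeasible.dualMatrixFeasible (h : DualFeasible μ ν) (hfin : FiniteSolution μ ν) :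
    DualMatrixFeasible (projSum μ) (projSum ν) where
  posSemidef_left := posSemidef_projSum h.nonneg_left
  posSemidef_right := posSemidef_projSum h.nonneg_right
  diag_le_one j := (re_projSum_add_projSum_apply_self hfin j).trans_le (h.le_one j)

namespace IsSpectralDecomposition

lemma finiteSolution (hμ : IsSpectralDecomposition M μ) (hν : IsSpectralDecomposition N ν) :
    FiniteSolution μ ν := ⟨hμ.finite, hν.finite⟩

lemma dualFeasible (hμ : IsSpectralDecomposition M μ) (hν : IsSpectralDecomposition N ν)
    (h : DualMatrixFeasible M N) : DualFeasible μ ν where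
  nonneg_left := hμ.nonneg
  nonneg_right := hν.nonneg
  summable_left j := summable_of_hasFiniteSupport
    (hμ.finite.subset (Function.support_mul_subset_left _ _))
  summable_right j := summable_of_hasFiniteSupport
    (hν.finite.subset (Function.support_mul_subset_left _ _))
  le_one j := by
    rw [← re_projSum_add_projSum_apply_self (hμ.finiteSolution hν), ← hμ.eq_sum, ← hν.eq_sum]
    exact h.diag_le_one j

lemma trace_sub_mul (hX : X.IsHermitian) (hμ : IsSpectralDecomposition M μ)
    (hν : IsSpectralDecomposition N ν) : ((M - N) * X).trace = (dualValue X μ ν : ℂ) := by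
  rw [hμ.eq_sum, hν.eq_sum, trace_projSum_sub_projSum_mul hX (hμ.finiteSolution hν)]

end IsSpectralDecomposition

lemma projSum_extend {ι : Type*} [Fintype ι] {e : ι → UnitVec n} (he : Function.Injective e)
    (a : ι → ℝ) : projSum (Function.extend e a 0) = ∑ s, (a s : ℂ) • proj (e s) := by
  have hsupport (ξ : UnitVec n) :
      ((Function.extend e a 0 ξ : ℝ) : ℂ) • proj ξ ≠ 0 → ξ ∈ Set.range e := by
    contrapose!
    intro hξ
    simp [Function.extend_apply' _ _ _ hξ]
  calc projSum (Function.extend e a 0)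
      = ∑ᶠ ξ ∈ Set.range e, ((Function.extend e a 0 ξ : ℝ) : ℂ) • proj ξ := by
        rw [projSum, ← finsum_mem_univ]
        exact finsum_mem_inter_support_eq' _ _ _ fun ξ hξ => iff_of_true trivial (hsupport ξ hξ)
    _ = ∑ s, (a s : ℂ) • proj (e s) := by
        simp only [finsum_mem_range he, finsum_eq_sum_of_fintype, he.extend_apply]

/-- The eigenvectors of a Hermitian matrix provided by the spectral theorem, as unit vectors. -/
noncomputable def eigenUnitVec (hM : M.IsHermitian) (s : Fin n) : UnitVec n :=
  ⟨hM.eigenvectorBasis s, by simp⟩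

lemma eigenUnitVec_injective (hM : M.IsHermitian) : Function.Injective (eigenUnitVec hM) :=
  fun _ _ hst => hM.eigenvectorBasis.orthonormal.linearIndependent.injective
    (congr_arg Subtype.val hst)

lemma eq_sum_eigenvalues_smul_proj (hM : M.IsHermitian) :
    M = ∑ s, (hM.eigenvalues s : ℂ) • proj (eigenUnitVec hM s) := by
  ext i j
  conv_lhs => rw [hM.spectral_theorem, Unitary.conjStarAlgAut_apply]
  rw [Matrix.sum_apply, mul_apply]
  refine Finset.sum_congr rfl fun s _ => ?_
  simp only [Complex.coe_algebraMap, mul_diagonal, IsHermitian.eigenvectorUnitary_apply,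
    Function.comp_apply, star_apply, RCLike.star_def, proj, UnitVec.coord, eigenUnitVec,
    Matrix.smul_apply, vecMulVec_apply, Pi.star_apply, smul_eq_mul]
  ring

theorem exists_isSpectralDecomposition (hM : M.PosSemidef) :
    ∃ μ : UnitVec n → ℝ, IsSpectralDecomposition M μ := by
  have hinj := eigenUnitVec_injective hM.1
  have hsupport : Function.support (Function.extend (eigenUnitVec hM.1) hM.1.eigenvalues 0) ⊆
      Set.range (eigenUnitVec hM.1) := fun ξ hξ => by
    by_contra hrange
    exact hξ (Function.extend_apply' _ _ _ hrange)
  refine ⟨_, fun ξ => ?_, (Set.finite_range _).subset hsupport, ?_,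
    (eq_sum_eigenvalues_smul_proj hM.1).trans (projSum_extend hinj _).symm⟩
  · obtain ⟨s, rfl⟩ | hξ := em (ξ ∈ Set.range (eigenUnitVec hM.1))
    · rw [hinj.extend_apply]
      exact hM.eigenvalues_nonneg s
    · rw [Function.extend_apply' _ _ _ hξ, Pi.zero_apply]
  · choose s hs using hsupport
    have hvec (ξ : Function.support (Function.extend (eigenUnitVec hM.1) hM.1.eigenvalues 0)) :
        hM.1.eigenvectorBasis (s ξ.2) = (ξ : UnitVec n) := congr_arg Subtype.val (hs ξ.2)
    simp only [← hvec]
    refine hM.1.eigenvectorBasis.orthonormal.comp _ fun ξ ζ h => Subtype.ext ?_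
    rw [← hs ξ.2, ← hs ζ.2, h]

end Dual

section Separation

lemma nonneg_of_forall_nonpos_dotProduct_le {ι : Type*} [Fintype ι] {p : ι → ℝ} {u : ℝ}
    (h : ∀ a ≤ 0, p ⬝ᵥ a ≤ u) : 0 ≤ p := by
  classical
  intro j
  by_contra! hj
  have hu : 0 ≤ u := by simpa using h 0 le_rfl
  have hcoord : (u + 1) / p j ≤ 0 := div_nonpos_of_nonneg_of_nonpos (by linarith) hj.le
  have hle := h (Pi.single j ((u + 1) / p j)) (Pi.single_nonpos.2 hcoord)
  rw [dotProduct_single, mul_div_cancel₀ _ hj.ne] at hle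
  linarith

lemma exists_nonneg_forall_dotProduct_nonneg {ι : Type*} [Fintype ι] {K : Set (ι → ℝ)}
    (hK : Convex ℝ K) (hne : K.Nonempty) (h : ∀ w ∈ K, ∃ j, 0 ≤ w j) :
    ∃ p : ι → ℝ, 0 ≤ p ∧ p ≠ 0 ∧ ∀ w ∈ K, 0 ≤ p ⬝ᵥ w := by
  classical
  set U : Set (ι → ℝ) := Set.univ.pi fun _ => Set.Iio 0
  have hdisjoint : Disjoint U K := Set.disjoint_left.2 fun w hwU hwK =>
    (h w hwK).elim fun j hj => (hwU j trivial).not_ge hj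
  obtain ⟨f, u, hfU, hfK⟩ := geometric_hahn_banach_open (convex_pi fun _ _ => convex_Iio 0)
    (isOpen_set_pi Set.finite_univ fun _ _ => isOpen_Iio) hK hdisjoint
  have hf (w : ι → ℝ) : f w = (fun j => f (Pi.single j 1)) ⬝ᵥ w := by
    conv_lhs => rw [pi_eq_sum_univ' w, map_sum]
    simp [dotProduct, mul_comm]
  have hnonpos (a : ι → ℝ) (ha : a ≤ 0) : f a ≤ u := by
    have hclosure : closure U ⊆ {a | f a ≤ u} :=
      closure_minimal (fun a ha => (hfU a ha).le) (isClosed_le f.continuous continuous_const)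
    refine hclosure ?_
    rw [closure_pi_set]
    simpa [Pi.le_def] using ha
  have hu : 0 ≤ u := by simpa using hnonpos 0 le_rfl
  refine ⟨fun j => f (Pi.single j 1), nonneg_of_forall_nonpos_dotProduct_le (u := u)
    fun a ha => hf a ▸ hnonpos a ha, fun hzero => ?_, fun w hw => hf w ▸ hu.trans (hfK w hw)⟩
  obtain ⟨w, hw⟩ := hne
  have hneg := hfU (fun _ => -1) fun _ _ => Set.mem_Iio.2 neg_one_lt_zero
  have hwle := hfK w hw
  rw [hf, hzero, zero_dotProduct] at hneg hwle
  exact hwle.not_gt hneg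

lemma exists_mem_stdSimplex_forall_dotProduct_nonneg {ι : Type*} [Fintype ι] {K : Set (ι → ℝ)}
    (hK : Convex ℝ K) (hne : K.Nonempty) (h : ∀ w ∈ K, ∃ j, 0 ≤ w j) :
    ∃ p ∈ stdSimplex ℝ ι, ∀ w ∈ K, 0 ≤ p ⬝ᵥ w := by
  obtain ⟨p, hp, hp0, hpK⟩ := exists_nonneg_forall_dotProduct_nonneg hK hne h
  have hsum : 0 < ∑ j, p j := Fintype.sum_pos (hp.lt_of_ne' hp0)
  refine ⟨(∑ j, p j)⁻¹ • p, ⟨fun j => mul_nonneg (inv_nonneg.2 hsum.le) (hp j), ?_⟩,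
    fun w hw => ?_⟩
  · simp only [Pi.smul_apply, smul_eq_mul, ← Finset.mul_sum, inv_mul_cancel₀ hsum.ne']
  · rw [smul_dotProduct]
    exact mul_nonneg (inv_nonneg.2 hsum.le) (hpK w hw)

end Separation

section Compactness

variable {n : ℕ} {M N : Matrix (Fin n) (Fin n) ℂ}

lemma norm_le_of_dualMatrixFeasible_zero (h : DualMatrixFeasible M 0) :
    ‖M‖ ≤ ‖(of 1 : Matrix (Fin n) (Fin n) ℂ)‖ := by
  have hschur : schurNorm M ≤ 1 := by
    simpa using schurNorm_sub_le h.1 h.2 zero_le_one h.3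
  calc ‖M‖ = ‖M ⊙ of 1‖ := by rw [hadamard_of_one]
    _ ≤ schurNorm M * ‖(of 1 : Matrix (Fin n) (Fin n) ℂ)‖ := norm_hadamard_le _ _
    _ ≤ _ := mul_le_of_le_one_left (norm_nonneg _) hschur

lemma DualMatrixFeasible.symm (h : DualMatrixFeasible M N) : DualMatrixFeasible N M :=
  ⟨h.2, h.1, fun j => add_comm M N ▸ h.3 j⟩

lemma DualMatrixFeasible.right_zero (h : DualMatrixFeasible M N) : DualMatrixFeasible M 0 where
  posSemidef_left := h.1
  posSemidef_right := .zero
  diag_le_one j := by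
    have hN := (Complex.nonneg_iff.1 (h.2.diag_nonneg (i := j))).1
    have hle := h.3 j
    simp only [Matrix.add_apply, Complex.add_re] at hle
    simp only [add_zero]
    linarith

lemma isCompact_setOf_dualMatrixFeasible : IsCompact
    {p : Matrix (Fin n) (Fin n) ℂ × Matrix (Fin n) (Fin n) ℂ | DualMatrixFeasible p.1 p.2} := by
  refine Metric.isCompact_of_isClosed_isBounded ?_ (isBounded_iff_forall_norm_le.2
    ⟨‖(of 1 : Matrix (Fin n) (Fin n) ℂ)‖, fun p hp => max_le
      (norm_le_of_dualMatrixFeasible_zero hp.right_zero)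
      (norm_le_of_dualMatrixFeasible_zero hp.symm.right_zero)⟩)
  have hset : {p : Matrix (Fin n) (Fin n) ℂ × Matrix (Fin n) (Fin n) ℂ |
      DualMatrixFeasible p.1 p.2} =
      {p | 0 ≤ p.1} ∩ {p | 0 ≤ p.2} ∩ ⋂ j, {p | ((p.1 + p.2) j j).re ≤ 1} := by
    ext p
    simp only [Set.mem_ofPred_eq, Set.mem_inter_iff, Set.mem_iInter, nonneg_iff_posSemidef]
    exact ⟨fun h => ⟨⟨h.1, h.2⟩, h.3⟩, fun h => ⟨h.1.1, h.1.2, h.2⟩⟩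
  rw [hset]
  refine ((isClosed_le continuous_const continuous_fst).inter
    (isClosed_le continuous_const continuous_snd)).inter (isClosed_iInter fun j =>
      isClosed_le ?_ continuous_const)
  fun_prop

end Compactness

section StrongDuality

variable {n : ℕ} {X M N : Matrix (Fin n) (Fin n) ℂ} {c D : ℝ}

/-- The objective `Tr ((M - N) X)` of the dual program in matrix form; the trace is real when
`M`, `N` and `X` are self-adjoint. -/
noncomputable def dualMatrixValue (X M N : Matrix (Fin n) (Fin n) ℂ) : ℝ :=
  ((M - N) * X).trace.re

lemma dualMatrixValue_smul (a : ℝ) (X M N : Matrix (Fin n) (Fin n) ℂ) :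
    dualMatrixValue X (a • M) (a • N) = a * dualMatrixValue X M N := by
  rw [dualMatrixValue, ← smul_sub, smul_mul, trace_smul, Complex.smul_re, smul_eq_mul,
    dualMatrixValue]

lemma dualMatrixValue_le_schurNorm_mul (hM : M.IsHermitian) (hN : N.IsHermitian) :
    dualMatrixValue X M N ≤ schurNorm (M - N) * cbBNorm X :=
  calc dualMatrixValue X M N ≤ ‖((M - N) * X).trace‖ := Complex.re_le_norm _
    _ = ‖((M - N)ᴴ * X).trace‖ := by rw [(hM.sub hN).eq]
    _ ≤ _ := norm_trace_le_schurNorm_mul_cbBNorm _ _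

lemma dualMatrixValue_le_mul_cbBNorm (hM : M.PosSemidef) (hN : N.PosSemidef) (hc : 0 ≤ c)
    (hdiag : ∀ j, ((M + N) j j).re ≤ c) : dualMatrixValue X M N ≤ c * cbBNorm X :=
  (dualMatrixValue_le_schurNorm_mul hM.1 hN.1).trans <|
    mul_le_mul_of_nonneg_right (schurNorm_sub_le hM hN hc hdiag) (cbBNorm_nonneg X)

lemma DualMatrixFeasible.dualMatrixValue_le_cbBNorm (h : DualMatrixFeasible M N) :
    dualMatrixValue X M N ≤ cbBNorm X := by
  simpa only [one_mul] using dualMatrixValue_le_mul_cbBNorm h.1 h.2 zero_le_one h.3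

lemma dualMatrixValue_le_mul (hD : ∀ M N, DualMatrixFeasible M N → dualMatrixValue X M N ≤ D)
    (hM : M.PosSemidef) (hN : N.PosSemidef) (hc : 0 ≤ c) (hdiag : ∀ j, ((M + N) j j).re ≤ c) :
    dualMatrixValue X M N ≤ c * D := by
  obtain rfl | hc := hc.eq_or_lt
  · simpa only [zero_mul] using dualMatrixValue_le_mul_cbBNorm hM hN le_rfl hdiag
  · have hfeasible : DualMatrixFeasible (c⁻¹ • M) (c⁻¹ • N) :=
      ⟨hM.smul (inv_nonneg.2 hc.le), hN.smul (inv_nonneg.2 hc.le), fun j => by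
        rw [← smul_add, Matrix.smul_apply, Complex.smul_re, smul_eq_mul, inv_mul_le_one₀ hc]
        exact hdiag j⟩
    rw [← inv_mul_le_iff₀ hc, ← dualMatrixValue_smul]
    exact hD _ _ hfeasible

lemma dualMatrixFeasible_zero : DualMatrixFeasible (0 : Matrix (Fin n) (Fin n) ℂ) 0 :=
  ⟨.zero, .zero, fun _ => by simp⟩

lemma exists_dualMatrixFeasible_forall_dualMatrixValue_le (X : Matrix (Fin n) (Fin n) ℂ) :
    ∃ M N, DualMatrixFeasible M N ∧
      ∀ M' N', DualMatrixFeasible M' N' → dualMatrixValue X M' N' ≤ dualMatrixValue X M N := by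
  have hcontinuous : Continuous fun p : Matrix (Fin n) (Fin n) ℂ × Matrix (Fin n) (Fin n) ℂ =>
      dualMatrixValue X p.1 p.2 := by
    unfold dualMatrixValue
    fun_prop
  obtain ⟨p, hp, hmax⟩ := isCompact_setOf_dualMatrixFeasible.exists_isMaxOn
    ⟨(0, 0), dualMatrixFeasible_zero⟩ hcontinuous.continuousOn
  exact ⟨p.1, p.2, hp, fun M N h => hmax (a := (M, N)) h⟩

/-- The slack `j ↦ D (M + N)ⱼⱼ - Tr ((M - N) X)` at `q = (M, N)`: a weight `p` of total mass `1`
pairs nonnegatively with the slacks of all positive semidefinite `M`, `N` exactly when `D • p` is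
feasible for the primal program. -/
noncomputable def dualSlack (X : Matrix (Fin n) (Fin n) ℂ) (D : ℝ)
    (q : Matrix (Fin n) (Fin n) ℂ × Matrix (Fin n) (Fin n) ℂ) (j : Fin n) : ℝ :=
  D * ((q.1 + q.2) j j).re - dualMatrixValue X q.1 q.2

lemma isLinearMap_dualSlack (X : Matrix (Fin n) (Fin n) ℂ) (D : ℝ) :
    IsLinearMap ℝ (dualSlack X D) where
  map_add q q' := by
    ext j
    simp only [dualSlack, dualMatrixValue, Prod.fst_add, Prod.snd_add, Pi.add_apply,
      Matrix.add_apply, add_sub_add_comm, add_mul, trace_add, Complex.add_re]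
    ring
  map_smul a q := by
    ext j
    simp only [dualSlack, Prod.smul_fst, Prod.smul_snd, dualMatrixValue_smul, ← smul_add,
      Matrix.smul_apply, Complex.smul_re, Pi.smul_apply, smul_eq_mul]
    ring

lemma exists_dualSlack_nonneg [NeZero n]
    (hD : ∀ M N, DualMatrixFeasible M N → dualMatrixValue X M N ≤ D)
    (hM : M.PosSemidef) (hN : N.PosSemidef) : ∃ j, 0 ≤ dualSlack X D (M, N) j := by
  obtain ⟨j, hj⟩ := Finite.exists_max fun j => ((M + N) j j).re
  have hle := dualMatrixValue_le_mul hD hM hN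
    (Complex.nonneg_iff.1 ((hM.add hN).diag_nonneg (i := j))).1 hj
  exact ⟨j, sub_nonneg.2 (hle.trans_eq (mul_comm _ _))⟩

lemma dotProduct_dualSlack {p : Fin n → ℝ} (hp : p ∈ stdSimplex ℝ (Fin n))
    (X M N : Matrix (Fin n) (Fin n) ℂ) (D : ℝ) :
    p ⬝ᵥ dualSlack X D (M, N) =
      ∑ j, (D • p) j * ((M + N) j j).re - dualMatrixValue X M N := by
  simp only [dotProduct, dualSlack, mul_sub, Finset.sum_sub_distrib, ← Finset.sum_mul, hp.2,
    one_mul, Pi.smul_apply, smul_eq_mul, mul_left_comm, mul_assoc]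

theorem exists_primalFeasible_sum_eq [NeZero n]
    (hD : ∀ M N, DualMatrixFeasible M N → dualMatrixValue X M N ≤ D) :
    ∃ l, PrimalFeasible X l ∧ ∑ j, l j = D := by
  have hconvex : Convex ℝ (dualSlack X D '' Set.Ici 0) :=
    (convex_Ici 0).is_linear_image (isLinearMap_dualSlack X D)
  obtain ⟨p, hp, hpos⟩ := exists_mem_stdSimplex_forall_dotProduct_nonneg hconvex
    (Set.nonempty_Ici.image _) <| Set.forall_mem_image.2 fun q hq => exists_dualSlack_nonneg hD
      (nonneg_iff_posSemidef.1 hq.1) (nonneg_iff_posSemidef.1 hq.2)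
  have hweak {M N : Matrix (Fin n) (Fin n) ℂ} (hM : M.PosSemidef) (hN : N.PosSemidef) :
      dualMatrixValue X M N ≤ ∑ j, (D • p) j * ((M + N) j j).re :=
    sub_nonneg.1 <| dotProduct_dualSlack hp X M N D ▸
      hpos _ ⟨(M, N), ⟨hM.nonneg, hN.nonneg⟩, rfl⟩
  have hD0 : 0 ≤ D := by simpa [dualMatrixValue] using hD 0 0 dualMatrixFeasible_zero
  refine ⟨D • p, ⟨fun j => mul_nonneg hD0 (hp.1 j), fun ξ => ?_, fun η => ?_⟩, ?_⟩
  · simpa [dualMatrixValue, trace_proj_mul, quadForm, proj_apply_self, ← Complex.ofReal_pow]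
      using hweak (proj_posSemidef ξ) .zero
  · simpa [dualMatrixValue, trace_proj_mul, quadForm, proj_apply_self, ← Complex.ofReal_pow]
      using hweak .zero (proj_posSemidef η)
  · simp only [Pi.smul_apply, smul_eq_mul, ← Finset.mul_sum, hp.2, mul_one]

theorem exists_dualMatrixFeasible_eq_cbBNorm [NeZero n] (hX : X.IsHermitian) :
    ∃ M N, DualMatrixFeasible M N ∧ dualMatrixValue X M N = cbBNorm X := by
  obtain ⟨M, N, hMN, hmax⟩ := exists_dualMatrixFeasible_forall_dualMatrixValue_le X
  obtain ⟨l, hl, hsum⟩ := exists_primalFeasible_sum_eq hmax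
  exact ⟨M, N, hMN, hMN.dualMatrixValue_le_cbBNorm.antisymm (hsum ▸ hl.cbBNorm_le_sum hX)⟩

end StrongDuality

section Optimality

variable {n : ℕ} {X M N : Matrix (Fin n) (Fin n) ℂ} {μ ν : UnitVec n → ℝ}

theorem isLeast_primalValues [NeZero n] (hX : X.IsHermitian) :
    IsLeast (primalValues X) (cbBNorm X) := by
  obtain ⟨l, hl, hsum⟩ := exists_primalFeasible_sum_eq fun M N
    (h : DualMatrixFeasible M N) => h.dualMatrixValue_le_cbBNorm (X := X)
  refine ⟨⟨l, hl, hsum.symm⟩, ?_⟩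
  rintro _ ⟨l', hl', rfl⟩
  exact hl'.cbBNorm_le_sum hX

lemma DualFeasible.dualValue_le_cbBNorm [NeZero n] (hX : X.IsHermitian)
    (h : DualFeasible μ ν) : dualValue X μ ν ≤ cbBNorm X := by
  obtain ⟨l, hl, hsum⟩ := (isLeast_primalValues hX).1
  exact hsum ▸ h.dualValue_le_sum hl

theorem exists_finiteSolution_dualFeasible_dualValue_eq [NeZero n] (hX : X.IsHermitian) :
    ∃ μ ν : UnitVec n → ℝ,
      FiniteSolution μ ν ∧ DualFeasible μ ν ∧ dualValue X μ ν = cbBNorm X := by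
  obtain ⟨M, N, hMN, hvalue⟩ := exists_dualMatrixFeasible_eq_cbBNorm hX
  obtain ⟨μ, hμ⟩ := exists_isSpectralDecomposition hMN.posSemidef_left
  obtain ⟨ν, hν⟩ := exists_isSpectralDecomposition hMN.posSemidef_right
  refine ⟨μ, ν, hμ.finiteSolution hν, hμ.dualFeasible hν hMN, ?_⟩
  rw [← hvalue, dualMatrixValue, hμ.trace_sub_mul hX hν, Complex.ofReal_re]

theorem isGreatest_dualValues [NeZero n] (hX : X.IsHermitian) :
    IsGreatest (dualValues X) (cbBNorm X) := by
  obtain ⟨μ, ν, -, hμν, hvalue⟩ := exists_finiteSolution_dualFeasible_dualValue_eq hX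
  refine ⟨⟨μ, ν, hμν, hvalue.symm⟩, ?_⟩
  rintro _ ⟨μ', ν', h, rfl⟩
  exact h.dualValue_le_cbBNorm hX

lemma dualOptimal_iff [NeZero n] (hX : X.IsHermitian) :
    DualOptimal X μ ν ↔ DualFeasible μ ν ∧ dualValue X μ ν = cbBNorm X := by
  refine and_congr_right fun h => ⟨fun hmax => ?_, fun hvalue μ' ν' h' =>
    hvalue ▸ h'.dualValue_le_cbBNorm hX⟩
  obtain ⟨μ', ν', h', hvalue⟩ := (isGreatest_dualValues hX).1
  exact (h.dualValue_le_cbBNorm hX).antisymm (hvalue ▸ hmax μ' ν' h')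

theorem exists_finiteSolution_dualOptimal [NeZero n] (hX : X.IsHermitian) :
    ∃ μ ν : UnitVec n → ℝ, FiniteSolution μ ν ∧ DualOptimal X μ ν :=
  let ⟨μ, ν, hfin, h⟩ := exists_finiteSolution_dualFeasible_dualValue_eq hX
  ⟨μ, ν, hfin, (dualOptimal_iff hX).2 h⟩

theorem exists_isCbBFactorization [NeZero n] (hX : X.IsHermitian) :
    ∃ (B : Matrix (Fin n) (Fin n) ℂ) (ξ : Fin n → ℝ), IsCbBFactorization X ξ B ξ ∧
      B.IsHermitian := by
  obtain rfl | hX0 := eq_or_ne X 0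
  · exact ⟨0, _, isCbBFactorization_zero 0, isHermitian_zero⟩
  · obtain ⟨l, hl, hsum⟩ := (isLeast_primalValues hX).1
    have h := hl.isCbBFactorization hX hX0 hsum.symm
    exact ⟨_, _, h, (h.isHermitian_and_eq hX).1⟩

section SchurFactorization

variable {Y E S : Matrix (Fin n) (Fin n) ℂ}

lemma negProj_eq_posProj_neg (S : Matrix (Fin n) (Fin n) ℂ) : negProj S = posProj (-S) := by
  rw [negProj, posProj, sub_eq_add_neg]

lemma isStarProjection_posProj (hS : S.IsHermitian) (hS1 : S * S = 1) :
    IsStarProjection (posProj S) where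
  isIdempotentElem := by
    rw [IsIdempotentElem, posProj, smul_mul_smul_comm, add_mul, one_mul, mul_add, mul_one, hS1]
    module
  isSelfAdjoint := by
    simp [IsSelfAdjoint, posProj, star_eq_conjTranspose, hS.eq]

namespace IsSelfAdjointSchurFactorization

lemma mul_self (h : IsSelfAdjointSchurFactorization Y E S) : S * S = 1 := by
  simpa only [h.selfAdjoint.eq] using h.isometry

lemma posSemidef_posPart (h : IsSelfAdjointSchurFactorization Y E S) :
    (E * posProj S * E).PosSemidef := by
  simpa only [h.posSemidef.1.eq] using (nonneg_iff_posSemidef.1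
    (isStarProjection_posProj h.selfAdjoint h.mul_self).nonneg).mul_mul_conjTranspose_same E

lemma posSemidef_negPart (h : IsSelfAdjointSchurFactorization Y E S) :
    (E * negProj S * E).PosSemidef := by
  have hS1 : -S * -S = 1 := by rw [neg_mul_neg, h.mul_self]
  rw [negProj_eq_posProj_neg]
  simpa only [h.posSemidef.1.eq] using (nonneg_iff_posSemidef.1
    (isStarProjection_posProj h.selfAdjoint.neg hS1).nonneg).mul_mul_conjTranspose_same E

lemma posPart_sub_negPart (h : IsSelfAdjointSchurFactorization Y E S) :
    E * posProj S * E - E * negProj S * E = Y := by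
  have hdiff : posProj S - negProj S = S := by rw [posProj, negProj]; module
  rw [← sub_mul, ← mul_sub, hdiff, h.factor]

lemma dualMatrixFeasible (h : IsSelfAdjointSchurFactorization Y E S) (hY : schurNorm Y ≤ 1) :
    DualMatrixFeasible (E * posProj S * E) (E * negProj S * E) where
  posSemidef_left := h.posSemidef_posPart
  posSemidef_right := h.posSemidef_negPart
  diag_le_one j := by
    have hsum : posProj S + negProj S = 1 := by rw [posProj, negProj]; module
    rw [← add_mul, ← mul_add, hsum, mul_one]
    exact (h.diag_le j).trans hY

theorem dualOptimal [NeZero n] (hX : X.IsHermitian) (hY : schurNorm Y ≤ 1)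
    (htrace : (Y * X).trace = (cbBNorm X : ℂ)) (h : IsSelfAdjointSchurFactorization Y E S)
    (hμ : IsSpectralDecomposition (E * posProj S * E) μ)
    (hν : IsSpectralDecomposition (E * negProj S * E) ν) :
    FiniteSolution μ ν ∧ DualOptimal X μ ν ∧ dualValue X μ ν = cbBNorm X := by
  have hvalue : dualValue X μ ν = cbBNorm X := by
    rw [← Complex.ofReal_inj, ← hμ.trace_sub_mul hX hν, h.posPart_sub_negPart, htrace]
  exact ⟨hμ.finiteSolution hν,
    (dualOptimal_iff hX).2 ⟨hμ.dualFeasible hν (h.dualMatrixFeasible hY), hvalue⟩, hvalue⟩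

end IsSelfAdjointSchurFactorization

end SchurFactorization

namespace DualMatrixFeasible

lemma schurNorm_sub_eq_one (hX0 : X ≠ 0) (h : DualMatrixFeasible M N)
    (hvalue : dualMatrixValue X M N = cbBNorm X) : schurNorm (M - N) = 1 := by
  refine (schurNorm_sub_le h.1 h.2 zero_le_one h.3).antisymm ?_
  have hle := dualMatrixValue_le_schurNorm_mul (X := X) h.1.1 h.2.1
  rw [hvalue] at hle
  exact (le_mul_iff_one_le_left (cbBNorm_pos hX0)).1 hle

lemma schurNorm_add_eq_one (hX0 : X ≠ 0) (h : DualMatrixFeasible M N)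
    (hvalue : dualMatrixValue X M N = cbBNorm X) : schurNorm (M + N) = 1 := by
  have hdiag (j : Fin n) : ((M + N) j j).re ≤ schurNorm (M + N) :=
    (Complex.re_le_norm _).trans (norm_apply_self_le_schurNorm _ j)
  refine le_antisymm ?_ ?_
  · simpa only [sub_zero] using schurNorm_sub_le (h.1.add h.2) .zero zero_le_one
      (by simpa only [add_zero] using h.3)
  · exact (h.schurNorm_sub_eq_one hX0 hvalue).ge.trans
      (schurNorm_sub_le h.1 h.2 (schurNorm_nonneg _) hdiag)

end DualMatrixFeasible

theorem FiniteSolution.trace_eq_and_schurNorm_eq_one [NeZero n] (hX : X.IsHermitian)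
    (hfin : FiniteSolution μ ν) (hopt : DualOptimal X μ ν) :
    ((projSum μ - projSum ν) * X).trace = (cbBNorm X : ℂ) ∧
      (X ≠ 0 → schurNorm (projSum μ - projSum ν) = 1 ∧ schurNorm (projSum μ + projSum ν) = 1) := by
  obtain ⟨hfeasible, hvalue⟩ := (dualOptimal_iff hX).1 hopt
  have htrace := trace_projSum_sub_projSum_mul hX hfin
  rw [hvalue] at htrace
  have hmatrix := hfeasible.dualMatrixFeasible hfin
  have hmatrixValue : dualMatrixValue X (projSum μ) (projSum ν) = cbBNorm X := by
    rw [dualMatrixValue, htrace, Complex.ofReal_re]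
  exact ⟨htrace, fun hX0 => ⟨hmatrix.schurNorm_sub_eq_one hX0 hmatrixValue,
    hmatrix.schurNorm_add_eq_one hX0 hmatrixValue⟩⟩

end Optimality

end SchurLP

open SchurLP in
theorem theorem4p4 (n : ℕ) (hn : 0 < n) (X : Matrix (Fin n) (Fin n) ℂ) (hX : X.IsHermitian) :
    -- the optimal values of both programs
    IsLeast (primalValues X) (cbBNorm X) ∧
    IsGreatest (dualValues X) (cbBNorm X) ∧
    (∃ μ ν : UnitVec n → ℝ, FiniteSolution μ ν ∧ DualOptimal X μ ν) ∧
    -- the cbB-factorization and the optimal primal solution that it gives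
    (∃ (B : Matrix (Fin n) (Fin n) ℂ) (ξ : Fin n → ℝ),
      IsCbBFactorization X ξ B ξ ∧ B.IsHermitian ∧
      (X ≠ 0 → ∀ (η' : Fin n → ℝ) (B' : Matrix (Fin n) (Fin n) ℂ) (ξ' : Fin n → ℝ),
        IsCbBFactorization X η' B' ξ' → η' = ξ ∧ B' = B ∧ ξ' = ξ)) ∧
    (∀ (η : Fin n → ℝ) (B : Matrix (Fin n) (Fin n) ℂ) (ξ : Fin n → ℝ),
      IsCbBFactorization X η B ξ → PrimalOptimal X (fun j => cbBNorm X * ξ j ^ 2)) ∧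
    -- finite optimal dual solutions from self-adjoint Schur factorizations
    (∀ Y : Matrix (Fin n) (Fin n) ℂ, Y.IsHermitian → schurNorm Y = 1 →
      (Y * X).trace = (cbBNorm X : ℂ) →
      ∀ E S : Matrix (Fin n) (Fin n) ℂ, IsSelfAdjointSchurFactorization Y E S →
        (∃ μ ν : UnitVec n → ℝ, IsSpectralDecomposition (E * posProj S * E) μ ∧
          IsSpectralDecomposition (E * negProj S * E) ν) ∧
        ∀ μ ν : UnitVec n → ℝ, IsSpectralDecomposition (E * posProj S * E) μ →
          IsSpectralDecomposition (E * negProj S * E) ν →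
          FiniteSolution μ ν ∧ DualOptimal X μ ν ∧ dualValue X μ ν = cbBNorm X) ∧
    -- norming matrices from finite optimal dual solutions
    (∀ μ ν : UnitVec n → ℝ, FiniteSolution μ ν → DualOptimal X μ ν →
      ((projSum μ - projSum ν) * X).trace = (cbBNorm X : ℂ) ∧
      (X ≠ 0 → schurNorm (projSum μ - projSum ν) = 1 ∧
        schurNorm (projSum μ + projSum ν) = 1)) := by
  have : NeZero n := ⟨hn.ne'⟩
  refine ⟨isLeast_primalValues hX, isGreatest_dualValues hX, exists_finiteSolution_dualOptimal hX,
    ?_, fun η B ξ h => h.primalOptimal hX, fun Y _ hY htrace E S h => ⟨?_, fun μ ν hμ hν =>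
      h.dualOptimal hX hY.le htrace hμ hν⟩, fun μ ν hfin hopt =>
      hfin.trace_eq_and_schurNorm_eq_one hX hopt⟩
  · obtain ⟨B, ξ, h, hB⟩ := exists_isCbBFactorization hX
    exact ⟨B, ξ, h, hB, fun hX0 η' B' ξ' h' => h.unique hX0 h'⟩
  · obtain ⟨μ, hμ⟩ := exists_isSpectralDecomposition h.posSemidef_posPart
    obtain ⟨ν, hν⟩ := exists_isSpectralDecomposition h.posSemidef_negPart
    exact ⟨μ, ν, hμ, hν⟩
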